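/- **Setting.** Let $\mathcal K=\mathbb Q(\mathrm{Re})$, $\tilde{\mathcal K}=\mathbb Q(\mathrm{Re},h)$, and let $\mathcal R=\mathcal K\{p,u_1,u_2,u_3\}$ be the differential polynomial ring with commuting derivations $\partial_t,\partial_1,\partial_2,\partial_3$. Write $$f_i=\partial_t u_i+\sum_j u_j\partial_j u_i+\partial_i p-\tfrac1{\mathrm{Re}}\sum_j\partial_j^2u_i\ (i=1,2,3),\qquad f_4=\sum_i\partial_iu_i,\qquad f_5=\sum_i\partial_i^2p+\sum_i\partial_i\Big(\sum_j u_j\partial_ju_i\Big)$$ for the left-hand sides of the incompressible Navier–Stokes equations and of the pressure Poisson equation. On a four-dimensional grid $(t,x_1,x_2,x_3)$ with spacing $h$, let $\sigma^\theta$ $(\theta\in\mathbb Z^4)$ be the shifts by $\theta h$. For a submonoid $S\subseteq\mathbb Z^4$ let $\tilde{\mathcal R}_S$ be the polynomial ring over $\tilde{\mathcal K}$ in the variables $\sigma^\theta\tilde p,\sigma^\theta\tilde u_i$, $\theta\in S$, on which the shifts $\sigma^\theta$, $\theta\in S$, act. So $\tilde{\mathcal R}_{\mathbb Z_{\ge0}^4}$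 is the difference polynomial ring with non-negative shifts. For $F\subseteq\tilde{\mathcal R}_S$, $[F]$ and $\llbracket F\rrbracket$ denote the difference ideal and the perfect difference ideal of $\tilde{\mathcal R}_S$ generated by $F$ (a difference ideal $I$ is perfect if $\prod_{\theta}(\sigma^{\theta}\tilde f)^{k_\theta}\in I$, with finitely many $\theta\in S$ and $k_\theta\in\mathbb Z_{\ge 0}$, implies $\tilde f\in I$). For $F\subseteq\mathcal R$, $\llbracket F\rrbracket$ is the radical differential ideal generated by $F$. By Taylor expansion about the grid point every difference polynomial becomes a Laurent series in $h$ over $\mathcal R$. Write $\tilde f\to f$ if this series is $f+O(h)$. Write $\tilde f\rhd f$ if, after multiplication by a non-zero polynomial in $h$ that clears denominators, it is $h^df+O(h^{d+1})$ with $d\ge0$, where $f\neq0$ unless $\tilde f=0$. A system $\tilde F=(\tilde f_1,\dots,\tilde f_n)$ in $\tilde{\mathcal R}_S$ with $\tilde f_j\to f_j$ for all $j$ (an FDA to $F=(f_1,\dots,f_n)$) is *s-consistent* with $F$ if for every $\tilde f\in\llbracket\tilde F\rrbracket$ there is $f\in\llbracket F\rrbracket$ with $\tilde f\rhd f$. Let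 $D_t,D_1,D_2,D_3,\tilde\Delta$ be linear difference operators $\sum_\theta c_\theta\sigma^\theta$ (finite sums, $\theta\in\mathbb Z^4$, $c_\theta\in\tilde{\mathcal K}$) which approximate $\partial_t,\partial_1,\partial_2,\partial_3,\Delta$, i.e. whose values on each dependent variable tend to those of the differential operators in the sense of $\to$. Put $$\tilde f_i=D_t\tilde u_i+\sum_j\tilde u_jD_j\tilde u_i+D_i\tilde p-\tfrac1{\mathrm{Re}}\tilde\Delta\tilde u_i\ (i=1,2,3),\qquad \tilde f_4=\sum_iD_i\tilde u_i,\qquad \tilde f_5=\sum_iD_i^2\tilde p+\sum_iD_i\Big(\sum_j\tilde u_jD_j\tilde u_i\Big).$$ **(1) Difference Gröbner basis.** Assume that only $\sigma_t$ occurs in $D_t$, and only $\sigma_1,\sigma_2,\sigma_3$ occur in $D_1,D_2,D_3,\tilde\Delta$; that some positive power of $\sigma_t$ occurs in $D_t$; and that some shift occurring in $D_1,D_2$ or $D_3$ is lexicographically $\ge0$. Let $S=\mathbb Z_{\ge0}^4$ or $S=\mathbb Z_{\ge0}\times\mathbb Z^3$ (non-negative time shifts, arbitrary spatial shifts), and assume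 that all shifts occurring in $D_1,D_2,D_3,\tilde\Delta$ belong to $S$. Let $s\ge0$ be such that $\sigma_t^sD_t$ involves no negative shifts. Then $$\tilde G=\{\sigma_t^s\tilde f_1,\ \sigma_t^s\tilde f_2,\ \sigma_t^s\tilde f_3,\ \tilde f_4,\ \sigma_t^s\tilde f_5\}$$ is a difference Gröbner basis of the difference ideal $I=[\sigma_t^s\tilde f_1,\sigma_t^s\tilde f_2,\sigma_t^s\tilde f_3,\tilde f_4]$ of $\tilde{\mathcal R}_S$ for the lexicographic monomial ordering given by the ranking that compares shift exponents lexicographically with $\sigma_t\succ\sigma_1\succ\sigma_2\succ\sigma_3$ and then uses $\tilde p\succ\tilde u_1\succ\tilde u_2\succ\tilde u_3$. That is, $\tilde G\subset\tilde{\mathcal R}_S$, $[\tilde G]=I$, and for every non-zero $\tilde f\in I$ there are $\tilde g\in\tilde G$ and $\theta\in S$ such that $\sigma^\theta\,\mathrm{lm}(\tilde g)$ divides $\mathrm{lm}(\tilde f)$. **(2) s-consistency.** Without the additional assumptions of (1): for every submonoid $S\subseteq\mathbb Z^4$ (in particular $S=\mathbb Z^4_{\ge0}$) and all $a_1,\dots,a_5\in\mathbb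 Z^4$ with $\sigma^{a_j}\tilde f_j\in\tilde{\mathcal R}_S$ for $j=1,\dots,5$ (shifts that eliminate inadmissible shifts), the system $(\sigma^{a_1}\tilde f_1,\dots,\sigma^{a_5}\tilde f_5)$ is an FDA to $(f_1,\dots,f_5)$, i.e. $\sigma^{a_j}\tilde f_j\to f_j$ for all $j$, and it is s-consistent with $(f_1,\dots,f_5)$. -/

import Mathlib

noncomputable section

namespace NSFDA

/-! ### Coefficient fields, differential and difference polynomials

Directions are indexed by `Fin 4`: `0` is time `t`, and `1, 2, 3` (that is `i.succ` for `i : Fin 3`)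
are `x₁, x₂, x₃`.  Dependent variables are indexed by `Fin 4` as well: `0` is the pressure `p`, and
`1, 2, 3` (that is `i.succ`) are the velocity components `u, v, w`. -/

/-- The field `ℚ(Re)`. -/
abbrev KRe : Type := RatFunc ℚ

/-- The field `ℚ(Re, h) = ℚ(Re)(h)`. -/
abbrev KReh : Type := RatFunc KRe

/-- The Reynolds number. -/
def Re : KRe := RatFunc.X

/-- `ℚ(Re){u, p}`: the variable `(α, J)` is `∂^J u^(α)`. -/
abbrev DiffPoly : Type := MvPolynomial (Fin 4 × (Fin 4 → ℕ)) KRe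

/-- The derivation `∂_j`. -/
def pd (j : Fin 4) : Derivation KRe DiffPoly DiffPoly :=
  MvPolynomial.mkDerivation KRe fun v => MvPolynomial.X (v.1, v.2 + Pi.single j 1)

/-- Shift exponents `θ`, standing for `σ^θ = σ_t^{θ 0} σ₁^{θ 1} σ₂^{θ 2} σ₃^{θ 3}`. -/
abbrev Shift : Type := Fin 4 → ℤ

/-- Polynomials over `ℚ(Re, h)` in the grid functions and all their shifts:
the variable `(α, J)` is `σ^J ũ^(α)`. -/
abbrev GridPoly : Type := MvPolynomial (Fin 4 × Shift) KReh

/-- The shift automorphism `σ^θ`. -/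
def shift (θ : Shift) : GridPoly →ₐ[KReh] GridPoly :=
  MvPolynomial.rename fun v => (v.1, v.2 + θ)

/-- The difference polynomial ring in which only the shifts from the monoid `S` are admitted. -/
def diffRing (S : AddSubmonoid Shift) : Subalgebra KReh GridPoly :=
  MvPolynomial.supported KReh {v | v.2 ∈ S}

/-- All shifts are non-negative. -/
def nonnegShifts : AddSubmonoid Shift where
  carrier := {θ | ∀ j, 0 ≤ θ j}
  zero_mem' := fun _ => le_rfl
  add_mem' := fun ha hb j => add_nonneg (ha j) (hb j)

/-- Time shifts are non-negative, spatial shifts are arbitrary. -/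
def nonnegTimeShifts : AddSubmonoid Shift where
  carrier := {θ | 0 ≤ θ 0}
  zero_mem' := le_refl (0 : ℤ)
  add_mem' := fun {a b} (ha : 0 ≤ a 0) (hb : 0 ≤ b 0) => (add_nonneg ha hb : 0 ≤ a 0 + b 0)

/-! ### Ideals -/

/-- Difference ideals of `diffRing S`. -/
structure IsDifferenceIdeal (S : AddSubmonoid Shift) (I : Submodule (diffRing S) GridPoly) :
    Prop where
  le : ∀ f ∈ I, f ∈ diffRing S
  shift_mem : ∀ θ ∈ S, ∀ f ∈ I, shift θ f ∈ I

/-- Perfect difference ideals of `diffRing S`. -/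
structure IsPerfectIdeal (S : AddSubmonoid Shift) (I : Submodule (diffRing S) GridPoly) :
    Prop extends IsDifferenceIdeal S I where
  perfect : ∀ f ∈ diffRing S, ∀ (s : Finset Shift) (k : Shift → ℕ), (∀ θ ∈ s, θ ∈ S) →
    ∏ θ ∈ s, shift θ f ^ k θ ∈ I → f ∈ I

/-- The difference ideal `[F]` of `diffRing S` generated by `F ⊆ diffRing S`. -/
def differenceIdeal (S : AddSubmonoid Shift) (F : Set GridPoly) :
    Submodule (diffRing S) GridPoly :=
  sInf {I | IsDifferenceIdeal S I ∧ F ⊆ I}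

/-- The perfect difference ideal `⟦F⟧` of `diffRing S` generated by `F ⊆ diffRing S`. -/
def perfectIdeal (S : AddSubmonoid Shift) (F : Set GridPoly) :
    Submodule (diffRing S) GridPoly :=
  sInf {I | IsPerfectIdeal S I ∧ F ⊆ I}

/-- The radical differential ideal `⟦F⟧` generated by `F`. -/
def radicalDifferentialIdeal (F : Set DiffPoly) : Ideal DiffPoly :=
  sInf {I | I.IsRadical ∧ (∀ j, ∀ f ∈ I, pd j f ∈ I) ∧ F ⊆ I}

/-! ### Taylor expansion and consistency -/

/-- The coefficientwise map `ℚ(Re)((h)) → ℚ(Re){u, p}((h))`. -/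
def mapCoeff : LaurentSeries KRe →+* LaurentSeries DiffPoly where
  toFun x := HahnSeries.map x (MvPolynomial.C : KRe →+* DiffPoly)
  map_one' := by ext n; by_cases hn : n = 0 <;> simp [HahnSeries.coeff_one, hn]
  map_zero' := by ext n; simp
  map_add' x y := by ext n; simp
  map_mul' x y := HahnSeries.map_mul ((MvPolynomial.C : KRe →+* DiffPoly) : KRe →ₙ+* DiffPoly)

theorem mapCoeff_coeff (x : LaurentSeries KRe) (n : ℤ) :
    (mapCoeff x).coeff n = MvPolynomial.C (x.coeff n) := rfl

open scoped RatFunc in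
/-- Coefficients: `ℚ(Re, h) → ℚ(Re)((h)) → ℚ(Re){u, p}((h))`. -/
def coeffExpansion : KReh →+* LaurentSeries DiffPoly :=
  mapCoeff.comp (algebraMap KReh (LaurentSeries KRe))

/-- Taylor expansion of `σ^J ũ^(α)` about the grid point:
`∑_k h^k ∑_{|N| = k} (J^N / N!) ∂^N u^(α)`. -/
def taylorVar (v : Fin 4 × Shift) : PowerSeries DiffPoly :=
  PowerSeries.mk fun k => ∑ N ∈ Finset.piAntidiag (Finset.univ : Finset (Fin 4)) k,
    MvPolynomial.C (∏ j, (v.2 j : KRe) ^ N j / ((N j).factorial : KRe)) * MvPolynomial.X (v.1, N)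

/-- Taylor expansion in `h` about the grid point. -/
def taylor : GridPoly →+* LaurentSeries DiffPoly :=
  MvPolynomial.eval₂Hom coeffExpansion fun v => (taylorVar v : LaurentSeries DiffPoly)

/-- `f̃ → f` as `h → 0`. -/
def TendsTo (ft : GridPoly) (f : DiffPoly) : Prop :=
  (∀ n < 0, (taylor ft).coeff n = 0) ∧ (taylor ft).coeff 0 = f

/-- `f̃ ▷ f`: after clearing denominators, `f̃ = h^d f + O(h^{d+1})`.
The polynomial `f` is the leading coefficient, so `f = 0` is allowed only for `f̃ = 0`. -/
def Implies (ft : GridPoly) (f : DiffPoly) : Prop :=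
  (f = 0 → ft = 0) ∧ ∃ c : Polynomial KRe, c ≠ 0 ∧ ∃ d : ℕ,
    (∀ n < (d : ℤ), (taylor (MvPolynomial.C (algebraMap (Polynomial KRe) KReh c) * ft)).coeff n = 0) ∧
    (taylor (MvPolynomial.C (algebraMap (Polynomial KRe) KReh c) * ft)).coeff d = f

/-- `F̃` is an FDA to `F`: a w-consistent family in `diffRing S`. -/
def IsFDA (S : AddSubmonoid Shift) {n : ℕ} (Ft : Fin n → GridPoly) (F : Fin n → DiffPoly) : Prop :=
  (∀ j, Ft j ∈ diffRing S) ∧ ∀ j, TendsTo (Ft j) (F j)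

/-- The FDA `F̃` to `F` is s-consistent. -/
def SConsistent (S : AddSubmonoid Shift) {n : ℕ} (Ft : Fin n → GridPoly) (F : Fin n → DiffPoly) :
    Prop :=
  IsFDA S Ft F ∧
    ∀ ft ∈ perfectIdeal S (Set.range Ft),
      ∃ f ∈ radicalDifferentialIdeal (Set.range F), Implies ft f

/-! ### Ranking, leading monomials, difference Gröbner bases -/

/-- The ranking `≻_{TOP,lex}` with `σ_t ≻ σ₁ ≻ σ₂ ≻ σ₃` and `p ≻ u ≻ v ≻ w`. -/
def RankGT (x y : Fin 4 × Shift) : Prop :=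
  toLex y.2 < toLex x.2 ∨ (x.2 = y.2 ∧ x.1 < y.1)

/-- The lexicographic monomial ordering given by the ranking: `m ≺ m'` iff at the highest ranked
variable in which they differ, `m` has the smaller exponent. -/
def MonLT (m m' : (Fin 4 × Shift) →₀ ℕ) : Prop :=
  ∃ x, (∀ y, RankGT y x → m y = m' y) ∧ m x < m' x

/-- `m` is the leading monomial of `f`. -/
def IsLeadingMonomial (f : GridPoly) (m : (Fin 4 × Shift) →₀ ℕ) : Prop :=
  m ∈ f.support ∧ ∀ m' ∈ f.support, m' ≠ m → MonLT m' m

/-- The action of `σ^θ` on monomials. -/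
def shiftMon (θ : Shift) (m : (Fin 4 × Shift) →₀ ℕ) : (Fin 4 × Shift) →₀ ℕ :=
  m.mapDomain fun v => (v.1, v.2 + θ)

/-- `G` is a difference Gröbner basis of the difference ideal of `diffRing S` generated by `F`:
it generates the same ideal `I`, and for every non-zero `f ∈ I` there are `g ∈ G` and a shift
`θ ∈ S` such that `σ^θ lm(g)` divides `lm(f)`. -/
def IsDifferenceGroebnerBasis (S : AddSubmonoid Shift) (F G : Set GridPoly) : Prop :=
  (∀ g ∈ G, g ∈ diffRing S) ∧
  differenceIdeal S G = differenceIdeal S F ∧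
  ∀ f ∈ differenceIdeal S F, f ≠ 0 →
    ∃ mf, IsLeadingMonomial f mf ∧
      ∃ g ∈ G, ∃ mg, IsLeadingMonomial g mg ∧ ∃ θ ∈ S, shiftMon θ mg ≤ mf

/-! ### The Navier–Stokes system and its finite difference approximations -/

/-- `∂_t u_i + (u·∇) u_i + ∂_i p - (1/Re) Δ u_i`. -/
def momentum (i : Fin 3) : DiffPoly :=
  pd 0 (MvPolynomial.X (i.succ, 0))
    + ∑ j : Fin 3, MvPolynomial.X (j.succ, 0) * pd j.succ (MvPolynomial.X (i.succ, 0))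
    + pd i.succ (MvPolynomial.X (0, 0))
    - MvPolynomial.C (1 / Re) * ∑ j : Fin 3, pd j.succ (pd j.succ (MvPolynomial.X (i.succ, 0)))

/-- `∇·u`. -/
def continuity : DiffPoly :=
  ∑ i : Fin 3, pd i.succ (MvPolynomial.X (i.succ, 0))

/-- The pressure Poisson polynomial `Δ p + ∇·(u·∇)u`. -/
def poisson : DiffPoly :=
  ∑ i : Fin 3, pd i.succ (pd i.succ (MvPolynomial.X (0, 0)))
    + ∑ i : Fin 3, pd i.succ
        (∑ j : Fin 3, MvPolynomial.X (j.succ, 0) * pd j.succ (MvPolynomial.X (i.succ, 0)))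

/-- Linear difference operators `∑_θ c_θ σ^θ` with coefficients in `ℚ(Re, h)`. -/
abbrev DiffOp : Type := Shift →₀ KReh

/-- The action of a linear difference operator. -/
def act (D : DiffOp) (f : GridPoly) : GridPoly :=
  D.sum fun θ c => MvPolynomial.C c * shift θ f

/-- The difference operator `D` approximates the operator `P`. -/
def Approximates (D : DiffOp) (P : DiffPoly → DiffPoly) : Prop :=
  ∀ α : Fin 4, TendsTo (act D (MvPolynomial.X (α, 0))) (P (MvPolynomial.X (α, 0)))

/-- `D_t ũ_i + (ũ·D) ũ_i + D_i p̃ - (1/Re) Δ̃ ũ_i`. -/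
def discreteMomentum (Dt : DiffOp) (D : Fin 3 → DiffOp) (L : DiffOp) (i : Fin 3) : GridPoly :=
  act Dt (MvPolynomial.X (i.succ, 0))
    + ∑ j : Fin 3, MvPolynomial.X (j.succ, 0) * act (D j) (MvPolynomial.X (i.succ, 0))
    + act (D i) (MvPolynomial.X (0, 0))
    - MvPolynomial.C (RatFunc.C (1 / Re)) * act L (MvPolynomial.X (i.succ, 0))

/-- `D·ũ`. -/
def discreteContinuity (D : Fin 3 → DiffOp) : GridPoly :=
  ∑ i : Fin 3, act (D i) (MvPolynomial.X (i.succ, 0))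

/-- The discrete pressure Poisson polynomial `(D·D) p̃ + D·(ũ·D)ũ`. -/
def discretePoisson (D : Fin 3 → DiffOp) : GridPoly :=
  ∑ i : Fin 3, act (D i) (act (D i) (MvPolynomial.X (0, 0)))
    + ∑ i : Fin 3, act (D i)
        (∑ j : Fin 3, MvPolynomial.X (j.succ, 0) * act (D j) (MvPolynomial.X (i.succ, 0)))

end NSFDA

end

open NSFDA

namespace NSFDA

noncomputable section

/-! ### Laurent series: coefficientwise maps and extension of ring homomorphisms -/

section Laurent

variable {A B A' B' : Type*} [CommRing A] [CommRing B] [CommRing A'] [CommRing B']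

/-! Consistency rests on a solution of the discrete equations that is, modulo `h`, a generic
solution of the Navier–Stokes equations. Read as evolution equations along x₁, the momentum and
continuity equations determine ∂₁p, ∂₁u₁, ∂₁²u₂, ∂₁²u₃ through terms of lower weight, so together
with all their derivatives they form a triangular system. The Taylor expansions of the discrete
equations agree with this system modulo `h`. Their corrections contain derivatives of arbitrarily
high order, which destroys triangularity, but each carries a factor `h`. A Hensel argument
(`exists_hensel_solution`) therefore yields φ : R → R⟦h⟧ that annihilates all derivatives of the
expansions and whose constant term is the identity modulo the ideal of the differential equations.

Expansion about a symbolic grid point y turns shifts into translations of y. These are injective on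
Laurent series over a domain, so the kernel of `evalJet φ` cuts out a perfect difference ideal
(`evalJet_eq_zero_of_mem_perfectIdeal`). The discrete Poisson equation lies in it because
constant-coefficient difference operators commute (`sum_act_discreteMomentum`). If f̃ lies in the
kernel, the lowest coefficient of the vanishing image of its Taylor series says that the leading
coefficient f of f̃ is killed by φ modulo `h`; hence f lies in the differential ideal
(`exists_implies_of_evalJet_eq_zero`). For f̃ ≠ 0, f ≠ 0 by `taylor_injective`.

For the Gröbner basis, every leading monomial is a single variable. The momentum and Poisson
equations lead in four different dependent variables, so only the continuity equation and one
momentum equation overlap. The shifted integrability condition rewrites late time shifts of the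
continuity equation by earlier ones and by shifts of the other equations. The remaining generators
have pairwise distinct leading variables. Eliminating these variables is a substitution that kills
the ideal but preserves the coefficient of a leading monomial free of them
(`exists_lead_of_mem_span`). The leading coefficient of the Poisson equation is a sum of squares,
non-zero because ℚ(Re, h) is formally real. -/

/-- An additive map applied to each coefficient of a Laurent series. -/
def lmapAdd (f : A →+ B) : LaurentSeries A →+ LaurentSeries B where
  toFun x := HahnSeries.map x f
  map_zero' := by ext n; simp
  map_add' x y := by ext n; simp

@[simp]
theorem lmapAdd_coeff (f : A →+ B) (x : LaurentSeries A) (n : ℤ) :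
    (lmapAdd f x).coeff n = f (x.coeff n) := rfl

/-- A ring homomorphism applied to each coefficient of a Laurent series. -/
def lmap (f : A →+* B) : LaurentSeries A →+* LaurentSeries B where
  toFun x := HahnSeries.map x f
  map_one' := by ext n; by_cases hn : n = 0 <;> simp [HahnSeries.coeff_one, hn]
  map_zero' := by ext n; simp
  map_add' x y := by ext n; simp
  map_mul' x y := HahnSeries.map_mul (f : A →ₙ+* B)

@[simp]
theorem lmap_coeff (f : A →+* B) (x : LaurentSeries A) (n : ℤ) :
    (lmap f x).coeff n = f (x.coeff n) := rfl

theorem lmap_injective {f : A →+* B} (hf : Function.Injective f) :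
    Function.Injective (lmap f) := by
  intro x y h
  ext n
  apply hf
  simpa using congrArg (fun z => z.coeff n) h

theorem lmapAdd_single_mul (f : A →+ B) (n : ℤ) (x : LaurentSeries A) :
    lmapAdd f (HahnSeries.single n 1 * x) = HahnSeries.single n 1 * lmapAdd f x := by
  ext m
  obtain ⟨k, rfl⟩ : ∃ k, m = k + n := ⟨m - n, by ring⟩
  simp [HahnSeries.coeff_single_mul_add]

theorem coeff_single_mul' (n m : ℤ) (x : LaurentSeries A) :
    (HahnSeries.single n 1 * x : LaurentSeries A).coeff m = x.coeff (m - n) := by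
  obtain ⟨k, rfl⟩ : ∃ k, m = k + n := ⟨m - n, by ring⟩
  simp [HahnSeries.coeff_single_mul_add]

/-- A derivation applied to each coefficient satisfies the Leibniz rule. -/
theorem lmapAdd_leibniz (d : A →+ A) (hd : ∀ a b, d (a * b) = d a * b + a * d b)
    (x y : LaurentSeries A) :
    lmapAdd d (x * y) = lmapAdd d x * y + x * lmapAdd d y := by
  have h1 : (lmapAdd d x).support ⊆ x.support := by
    intro n hn h; exact hn (by simp [show x.coeff n = 0 from h])
  have h2 : (lmapAdd d y).support ⊆ y.support := by
    intro n hn h; exact hn (by simp [show y.coeff n = 0 from h])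
  ext n
  rw [HahnSeries.coeff_add', Pi.add_apply, lmapAdd_coeff, HahnSeries.coeff_mul,
    HahnSeries.coeff_mul_left' x.isPWO_support h1, HahnSeries.coeff_mul_right' y.isPWO_support h2,
    map_sum, ← Finset.sum_add_distrib]
  exact Finset.sum_congr rfl fun ij _ => by simp [hd]

theorem exists_eq_single_mul (x : LaurentSeries A) (n : ℤ) (h : ∀ i < n, x.coeff i = 0) :
    ∃ G : PowerSeries A, x = HahnSeries.single n 1 * (G : LaurentSeries A) ∧
      ∀ k : ℕ, PowerSeries.coeff k G = x.coeff (n + k) := by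
  refine ⟨PowerSeries.mk fun k => x.coeff (n + k), ?_, fun k => by simp⟩
  ext m
  rw [coeff_single_mul', PowerSeries.coeff_coe]
  split_ifs with hm
  · exact h m (by lia)
  · simp only [PowerSeries.coeff_mk]
    congr 1
    lia

theorem exists_coeff_bound (x : LaurentSeries A) : ∃ n : ℤ, ∀ i < n, x.coeff i = 0 :=
  ⟨x.order, fun _ hi => HahnSeries.coeff_eq_zero_of_lt_order hi⟩

/-- The extension of `φ : A → B⟦h⟧` to a ring homomorphism `A⟦h⟧ → B⟦h⟧` with `h ↦ h`. -/
def hatP (φ : A →+* PowerSeries B) : PowerSeries A →+* PowerSeries B where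
  toFun F := PowerSeries.mk fun n => ∑ ij ∈ Finset.HasAntidiagonal.antidiagonal n,
    PowerSeries.coeff ij.2 (φ (PowerSeries.coeff ij.1 F))
  map_zero' := by ext n; simp
  map_add' F G := by ext n; simp [Finset.sum_add_distrib]
  map_one' := by
    ext n
    rw [PowerSeries.coeff_mk, Finset.sum_eq_single (0, n)]
    · simp
    · rintro ⟨i, j⟩ hij hne
      have : i ≠ 0 := by
        rintro rfl
        simp only [Finset.HasAntidiagonal.mem_antidiagonal, zero_add] at hij
        exact hne (by rw [hij])
      simp [PowerSeries.coeff_one, this]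
    · simp
  map_mul' F G := by
    ext n
    simp only [PowerSeries.coeff_mk, PowerSeries.coeff_mul, map_sum, map_mul, Finset.sum_mul_sum,
      Finset.sum_sigma']
    -- Both sides run over quadruples of total degree `n`; the bijection interchanges the two middle
    -- entries and is its own inverse.
    refine Finset.sum_nbij'
      (fun z => ⟨(z.2.1.1 + z.2.2.1, z.2.1.2 + z.2.2.2), ⟨(z.2.1.1, z.2.2.1), (z.2.1.2, z.2.2.2)⟩⟩)
      (fun z => ⟨(z.2.1.1 + z.2.2.1, z.2.1.2 + z.2.2.2), ⟨(z.2.1.1, z.2.2.1), (z.2.1.2, z.2.2.2)⟩⟩)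
      ?_ ?_ ?_ ?_ ?_
    all_goals
      rintro ⟨⟨i, j⟩, ⟨⟨a, b⟩, ⟨c, d⟩⟩⟩ h
      simp only [Finset.mem_sigma, Finset.HasAntidiagonal.mem_antidiagonal] at h ⊢
    · lia
    · lia
    · obtain ⟨h1, rfl, rfl⟩ := h; rfl
    · obtain ⟨h1, rfl, rfl⟩ := h; rfl

theorem coeff_hatP (φ : A →+* PowerSeries B) (F : PowerSeries A) (n : ℕ) :
    PowerSeries.coeff n (hatP φ F) = ∑ ij ∈ Finset.HasAntidiagonal.antidiagonal n,
      PowerSeries.coeff ij.2 (φ (PowerSeries.coeff ij.1 F)) := by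
  simp [hatP]

theorem hatP_C (φ : A →+* PowerSeries B) (a : A) : hatP φ (PowerSeries.C a) = φ a := by
  ext n
  rw [coeff_hatP, Finset.sum_eq_single (0, n)]
  · simp
  · rintro ⟨i, j⟩ hij hne
    have : i ≠ 0 := by
      rintro rfl
      simp only [Finset.HasAntidiagonal.mem_antidiagonal, zero_add] at hij
      exact hne (by rw [hij])
    simp [PowerSeries.coeff_C, this]
  · simp

theorem hatP_X (φ : A →+* PowerSeries B) : hatP φ PowerSeries.X = PowerSeries.X := by
  ext n
  rw [coeff_hatP]
  cases n with
  | zero => simp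
  | succ n =>
    rw [Finset.sum_eq_single (1, n)]
    · simp [PowerSeries.coeff_X, PowerSeries.coeff_one]
    · rintro ⟨i, j⟩ hij hne
      have : i ≠ 1 := by
        rintro rfl
        simp only [Finset.HasAntidiagonal.mem_antidiagonal] at hij
        exact hne (by simp; lia)
      simp [PowerSeries.coeff_X, this]
    · simp [add_comm]

theorem coeff_zero_hatP (φ : A →+* PowerSeries B) (F : PowerSeries A) :
    PowerSeries.coeff 0 (hatP φ F) = PowerSeries.coeff 0 (φ (PowerSeries.coeff 0 F)) := by
  simp [coeff_hatP]

theorem isUnit_single (n : ℤ) : IsUnit (HahnSeries.single n 1 : LaurentSeries A) :=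
  IsUnit.of_mul_eq_one (HahnSeries.single (-n) 1) (by simp)

/-- The extension of `φ : A → B⟦h⟧` to a ring homomorphism `A((h)) → B((h))` with `h ↦ h`. -/
def hat (φ : A →+* PowerSeries B) : LaurentSeries A →+* LaurentSeries B :=
  IsLocalization.lift (M := Submonoid.powers (PowerSeries.X : PowerSeries A))
    (g := (HahnSeries.ofPowerSeries ℤ B).comp (hatP φ)) <| by
    rintro ⟨_, k, rfl⟩
    simp only [map_pow, RingHom.comp_apply, hatP_X, PowerSeries.coe_X]
    exact (isUnit_single 1).pow k

theorem hat_coe (φ : A →+* PowerSeries B) (F : PowerSeries A) :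
    hat φ (F : LaurentSeries A) = (hatP φ F : LaurentSeries B) :=
  IsLocalization.lift_eq _ F

theorem hat_single_one (φ : A →+* PowerSeries B) (n : ℤ) :
    hat φ (HahnSeries.single n 1) = HahnSeries.single n 1 := by
  have key (k : ℕ) : hat φ (HahnSeries.single (k : ℤ) 1) = HahnSeries.single (k : ℤ) 1 := by
    have := hat_coe φ (PowerSeries.X ^ k)
    simpa [hatP_X] using this
  obtain ⟨k, rfl | rfl⟩ := n.eq_nat_or_neg
  · exact key k
  · have h0 : (HahnSeries.single (-(k : ℤ)) (1 : A)) * (HahnSeries.single (k : ℤ) (1 : A)) = 1 := by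
      simp
    have h1 := congrArg (hat φ) h0
    rw [map_mul, key, map_one (hat φ)] at h1
    exact (isUnit_single (A := B) (k : ℤ)).mul_right_cancel (by rw [h1]; simp)

theorem hat_single_mul (φ : A →+* PowerSeries B) (n : ℤ) (G : PowerSeries A) :
    hat φ (HahnSeries.single n 1 * (G : LaurentSeries A)) =
      HahnSeries.single n 1 * (hatP φ G : LaurentSeries B) := by
  rw [map_mul, hat_single_one, hat_coe]

theorem hat_C (φ : A →+* PowerSeries B) (a : A) :
    hat φ (HahnSeries.C a) = (φ a : LaurentSeries B) := by
  rw [← PowerSeries.coe_C, hat_coe, hatP_C]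

theorem hat_coeff_of_lt (φ : A →+* PowerSeries B) (x : LaurentSeries A) (n : ℤ)
    (h : ∀ i < n, x.coeff i = 0) {i : ℤ} (hi : i < n) : (hat φ x).coeff i = 0 := by
  obtain ⟨G, rfl, -⟩ := exists_eq_single_mul x n h
  rw [hat_single_mul, coeff_single_mul', PowerSeries.coeff_coe, if_pos (by lia)]

/-- Since `φ` produces no negative powers of `h`, the lowest coefficient of the image sees only the
lowest coefficient of `x` and the constant term of `φ`. This is what later places leading
coefficients in the differential ideal. -/
theorem hat_coeff_lead (φ : A →+* PowerSeries B) (x : LaurentSeries A) (n : ℤ)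
    (h : ∀ i < n, x.coeff i = 0) :
    (hat φ x).coeff n = PowerSeries.coeff 0 (φ (x.coeff n)) := by
  obtain ⟨G, hx, hG⟩ := exists_eq_single_mul x n h
  have h0 := hG 0
  simp only [Nat.cast_zero, add_zero] at h0
  rw [← h0, hx, hat_single_mul, coeff_single_mul', PowerSeries.coeff_coe, if_neg (by lia)]
  simp [coeff_zero_hatP]

/-- The coefficients of the extension are sums of coefficients of `φ`, so additive maps suffice for
compatibility. This permits extraction of a coefficient in y, which is not multiplicative. -/
theorem hat_naturality (φ' : A' →+* PowerSeries B') (φ : A →+* PowerSeries B) (α : A' →+ A)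
    (β : B' →+ B)
    (h : ∀ a k, β (PowerSeries.coeff k (φ' a)) = PowerSeries.coeff k (φ (α a)))
    (x : LaurentSeries A') : lmapAdd β (hat φ' x) = hat φ (lmapAdd α x) := by
  obtain ⟨n, hn⟩ := exists_coeff_bound x
  obtain ⟨G, rfl, -⟩ := exists_eq_single_mul x n hn
  have hα : lmapAdd α (G : LaurentSeries A') =
      ((PowerSeries.mk fun k => α (PowerSeries.coeff k G) : PowerSeries A) : LaurentSeries A) := by
    ext m
    rw [lmapAdd_coeff, PowerSeries.coeff_coe, PowerSeries.coeff_coe]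
    split_ifs <;> simp
  rw [hat_single_mul, lmapAdd_single_mul, lmapAdd_single_mul, hα, hat_single_mul]
  congr 1
  ext m
  rw [lmapAdd_coeff, PowerSeries.coeff_coe, PowerSeries.coeff_coe]
  split_ifs
  · simp
  · simp [coeff_hatP, h]

end Laurent

end

end NSFDA

namespace NSFDA

noncomputable section

/-! ### Triangular systems of equations -/

section Triangular

open MvPolynomial

variable {V k : Type*} [CommRing k]

theorem aeval_eq_of_supported {C : Type*} [CommRing C] [Algebra k C] {s : Set V}
    {p : MvPolynomial V k} (hp : p ∈ supported k s) {x y : V → C} (h : ∀ v ∈ s, x v = y v) :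
    aeval x p = aeval y p := by
  refine eval₂Hom_congr' rfl (fun i hi _ => h i ?_) rfl
  exact (mem_supported.1 hp) hi

/-- Well-founded recursion: variables not below `v` get the default value 0, which `g v` never
reads. It serves both the weight order of the Hensel argument and the ranking in the elimination. -/
theorem exists_triangular_solution {C : Type*} [CommRing C] [Algebra k C] {r : V → V → Prop}
    (hr : WellFounded r) (g : V → MvPolynomial V k) (hg : ∀ v, g v ∈ supported k {w | r w v})
    (x : V → C) : ∃ S : V → C, ∀ v, S v = x v + aeval S (g v) := by
  classical
  let S : V → C := hr.fix fun v rec => x v + aeval (fun w => if h : r w v then rec w h else 0) (g v)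
  refine ⟨S, fun v => ?_⟩
  have h := hr.fix_eq (C := fun _ => C)
    (fun v rec => x v + aeval (fun w => if h : r w v then rec w h else 0) (g v)) v
  refine h.trans (congrArg (x v + ·) (aeval_eq_of_supported (hg v) fun w hw => ?_))
  exact dif_pos hw

variable {B : Type*} [CommRing B]

/-- Congruence modulo `a` is equality in a quotient, and evaluation commutes with the quotient map.
-/
theorem dvd_aeval_sub {C : Type*} [CommRing C] [Algebra k C] {s : Set V} {p : MvPolynomial V k}
    (hp : p ∈ supported k s) {x y : V → C} {a : C} (h : ∀ v ∈ s, a ∣ x v - y v) :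
    a ∣ aeval x p - aeval y p := by
  have key (z : V → C) : Ideal.Quotient.mkₐ k (Ideal.span {a}) (aeval z p) =
      aeval (fun v => Ideal.Quotient.mkₐ k (Ideal.span {a}) (z v)) p := by
    rw [← AlgHom.comp_apply, comp_aeval]
  rw [← Ideal.mem_span_singleton, ← Ideal.Quotient.eq]
  refine (key x).trans (Eq.trans ?_ (key y).symm)
  refine aeval_eq_of_supported hp fun v hv => ?_
  exact Ideal.Quotient.eq.2 (Ideal.mem_span_singleton.2 (h v hv))

/-! ### Fixed points in the `h`-adic topology and Hensel's lemma -/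

/-- A map that is contracting for the `h`-adic topology has a fixed point. -/
theorem exists_fixedPoint (S : (V → PowerSeries B) → V → PowerSeries B)
    (hS : ∀ n x y, (∀ v, PowerSeries.X ^ n ∣ x v - y v) →
      ∀ v, PowerSeries.X ^ (n + 1) ∣ S x v - S y v) : ∃ x, S x = x := by
  let s : ℕ → V → PowerSeries B := fun n => S^[n] 0
  have hs (n) : s (n + 1) = S (s n) := Function.iterate_succ_apply' S n 0
  have h1 (n) : ∀ v, PowerSeries.X ^ n ∣ s (n + 1) v - s n v := by
    induction n with
    | zero => simp
    | succ n ih => intro v; rw [hs (n + 1)]; nth_rw 2 [hs n]; exact hS n _ _ ih v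
  have h2 (n m : ℕ) : ∀ v, PowerSeries.X ^ n ∣ s (n + m) v - s n v := by
    induction m with
    | zero => simp
    | succ m ih =>
      intro v
      have := dvd_add ((pow_dvd_pow _ (by lia)).trans (h1 (n + m) v)) (ih v)
      simpa [add_assoc] using this
  -- The coefficient of hⁿ is constant from the iterate `n + 1` on, since consecutive iterates agree
  -- modulo hⁿ⁺¹ there.
  let x : V → PowerSeries B := fun v => PowerSeries.mk fun n => PowerSeries.coeff n (s (n + 1) v)
  have h3 (n) : ∀ v, PowerSeries.X ^ n ∣ x v - s n v := by
    intro v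
    rw [PowerSeries.X_pow_dvd_iff]
    intro m hm
    obtain ⟨l, rfl⟩ := Nat.exists_eq_add_of_le (Nat.succ_le_of_lt hm)
    have := (PowerSeries.X_pow_dvd_iff.1 (h2 (m + 1) l v)) m (by lia)
    rw [map_sub, sub_eq_zero] at this
    rw [map_sub, sub_eq_zero, PowerSeries.coeff_mk, ← this]
  refine ⟨x, funext fun v => ?_⟩
  rw [← sub_eq_zero]
  ext n
  have h4 : PowerSeries.X ^ (n + 1) ∣ S x v - x v := by
    have := dvd_sub (hS n x (s n) (h3 n) v) (h3 (n + 1) v)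
    rw [hs] at this
    simpa using this
  simpa using (PowerSeries.X_pow_dvd_iff.1 h4) n (by lia)

/-- A series without constant term is divisible by `h`, so the error of `φ` gains one power of `h`.
This is the source of the contraction. -/
theorem dvd_hatP_sub {A : Type*} [CommRing A] (φ ψ : A →+* PowerSeries B) (n : ℕ)
    (h : ∀ a, PowerSeries.X ^ n ∣ φ a - ψ a) (F : PowerSeries A)
    (hF : PowerSeries.coeff 0 F = 0) :
    PowerSeries.X ^ (n + 1) ∣ hatP φ F - hatP ψ F := by
  rw [PowerSeries.X_pow_dvd_iff]
  intro m hm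
  rw [map_sub, coeff_hatP, coeff_hatP, ← Finset.sum_sub_distrib]
  refine Finset.sum_eq_zero fun ij hij => ?_
  rw [Finset.HasAntidiagonal.mem_antidiagonal] at hij
  rcases Nat.eq_zero_or_pos ij.1 with h0 | h0
  · simp [h0, hF]
  · rw [← map_sub]
    exact (PowerSeries.X_pow_dvd_iff.1 (h _)) _ (by lia)

/-- Hensel's lemma for triangular systems: if `F v` is `X v` plus terms of lower weight modulo `h`,
then all `F v` with `v ∈ V'` have a common zero in `k[V]⟦h⟧`. -/
theorem exists_hensel_solution (wt : V → ℕ) (V' : Set V)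
    (F : V → PowerSeries (MvPolynomial V k))
    (hF : ∀ v ∈ V', PowerSeries.coeff 0 (F v) - X v ∈ supported k {w | wt w < wt v}) :
    ∃ φ : MvPolynomial V k →+* PowerSeries (MvPolynomial V k),
      (∀ v ∈ V', hatP φ (F v) = 0) ∧
      (∀ a, φ (C a) = PowerSeries.C (C a)) ∧
      ∀ p, p - PowerSeries.coeff 0 (φ p) ∈
        Ideal.span ((fun v => PowerSeries.coeff 0 (F v)) '' V') := by
  classical
  -- The constant term of `F v` is `X v - g v`. With `F'` the part divisible by `h`, the equation
  -- becomes `x v = -hatP (φ x) (F' v) + φ x (g v)`; variables outside `V'` are free.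
  let g : V → MvPolynomial V k := fun v => if v ∈ V' then X v - PowerSeries.coeff 0 (F v) else 0
  have hg (v) : g v ∈ supported k {w | wt w < wt v} := by
    by_cases hv : v ∈ V'
    · simp only [g, if_pos hv]
      rw [← neg_sub]
      exact neg_mem (hF v hv)
    · simp only [g, if_neg hv]; exact zero_mem _
  let F' : V → PowerSeries (MvPolynomial V k) := fun v => F v - PowerSeries.C (PowerSeries.coeff 0 (F v))
  have hF' (v) : PowerSeries.coeff 0 (F' v) = 0 := by simp [F']
  let φ : (V → PowerSeries (MvPolynomial V k)) → MvPolynomial V k →ₐ[k] PowerSeries (MvPolynomial V k) := fun x => aeval x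
  let inh : (V → PowerSeries (MvPolynomial V k)) → V → PowerSeries (MvPolynomial V k) := fun x v =>
    if v ∈ V' then - hatP (φ x : MvPolynomial V k →+* PowerSeries (MvPolynomial V k)) (F' v) else PowerSeries.C (X v)
  have hwf : WellFounded fun w v : V => wt w < wt v := (measure wt).wf
  -- One iteration freezes the `h`-part at `x` and solves the triangular part exactly. The frozen
  -- part gains a power of `h`, and induction on the weight carries this through the triangular
  -- part.
  choose S hS using fun x => exists_triangular_solution hwf g hg (inh x)
  obtain ⟨x, hx⟩ := exists_fixedPoint S (by
    intro n x y hxy v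
    induction v using hwf.induction with
    | _ v ih =>
      rw [hS x v, hS y v, add_sub_add_comm]
      refine dvd_add ?_ (dvd_aeval_sub (hg v) ih)
      by_cases hv : v ∈ V'
      · simp only [inh, if_pos hv]
        rw [neg_sub_neg]
        refine dvd_hatP_sub _ _ n (fun a => ?_) _ (hF' v)
        refine dvd_aeval_sub (mem_supported_vars a) fun v _ => ?_
        rw [← neg_sub, dvd_neg]
        exact hxy v
      · simp [inh, if_neg hv])
  have hφX (v) : φ x (X v) = x v := aeval_X x v
  have hxv (v) (hv : v ∈ V') : hatP (φ x : MvPolynomial V k →+* PowerSeries (MvPolynomial V k)) (F v) = 0 := by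
    have h1 := hS x v
    rw [hx] at h1
    simp only [inh, if_pos hv, F', map_sub, hatP_C] at h1
    have h2 : φ x (g v) = x v - φ x (PowerSeries.coeff 0 (F v)) := by
      simp only [g, if_pos hv, map_sub, hφX]
    change x v = _ + φ x (g v) at h1
    rw [h2] at h1
    simp only [RingHom.coe_coe] at h1
    linear_combination h1
  refine ⟨(φ x : MvPolynomial V k →+* PowerSeries (MvPolynomial V k)), hxv, fun a => ?_, ?_⟩
  · exact (aeval_C x a).trans (PowerSeries.algebraMap_apply ..)
  · set I : Ideal (MvPolynomial V k) := Ideal.span ((fun v => PowerSeries.coeff 0 (F v)) '' V') with hI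
    let ε : MvPolynomial V k →ₐ[k] MvPolynomial V k := (aeval fun v => PowerSeries.coeff 0 (x v))
    have hε (p) : PowerSeries.coeff 0 (φ x p) = ε p := by
      have : ((PowerSeries.constantCoeff : PowerSeries (MvPolynomial V k) →+* MvPolynomial V k).comp
          (φ x : MvPolynomial V k →+* PowerSeries (MvPolynomial V k))) = (ε : MvPolynomial V k →+* MvPolynomial V k) := by
        refine MvPolynomial.ringHom_ext (fun a => ?_) (fun v => ?_)
        · simp [φ, ε, PowerSeries.algebraMap_apply]
        · simp [φ, ε]
      simpa using congrArg (fun f => f p) this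
    -- Modulo `h` the frozen part disappears, so the solution satisfies the same triangular
    -- recursion as the variables do modulo `I`; the two agree by induction on the weight.
    have key (v) : X v - ε (X v) ∈ I := by
      induction v using hwf.induction with
      | _ v ih =>
        have h1 := congrArg (PowerSeries.coeff 0) (hS x v)
        rw [hx, map_add] at h1
        change _ = _ + PowerSeries.coeff 0 (φ x (g v)) at h1
        rw [hε] at h1
        have h2 : ε (X v) = PowerSeries.coeff 0 (x v) := aeval_X _ v
        rw [h2, h1]
        by_cases hv : v ∈ V'
        · have h3 : PowerSeries.coeff 0 (inh x v) = 0 := by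
            simp only [inh, if_pos hv, map_neg, coeff_zero_hatP, hF', map_zero, neg_zero]
          have h4 : g v - ε (g v) ∈ I := by
            -- Divisibility by 0 in the quotient is equality there, and `g v` involves only
            -- variables covered by the induction hypothesis.
            have := dvd_aeval_sub (C := MvPolynomial V k ⧸ I) (a := 0) (hg v)
              (x := fun w => Ideal.Quotient.mk I (X w)) (y := fun w => Ideal.Quotient.mk I (ε (X w)))
              (fun w hw => by
                rw [zero_dvd_iff, sub_eq_zero]
                exact Ideal.Quotient.eq.2 (ih w hw))
            rw [zero_dvd_iff, sub_eq_zero] at this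
            rw [← Ideal.Quotient.eq]
            have e1 : aeval (fun w => Ideal.Quotient.mk I (X w)) (g v) =
                Ideal.Quotient.mkₐ k I (g v) := by
              conv_rhs => rw [← MvPolynomial.aeval_X_left_apply (R := k) (g v)]
              rw [← AlgHom.comp_apply, comp_aeval]; rfl
            have e2 : aeval (fun w => Ideal.Quotient.mk I (ε (X w))) (g v) =
                Ideal.Quotient.mkₐ k I (ε (g v)) := by
              rw [← AlgHom.comp_apply, comp_aeval]
              simp [ε]
            rw [e1, e2] at this
            exact this
          have h5 : X v - (0 + ε (g v)) = PowerSeries.coeff 0 (F v) + (g v - ε (g v)) := by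
            simp only [g, if_pos hv]; ring
          rw [h3, h5]
          exact add_mem (Ideal.subset_span ⟨v, hv, rfl⟩) h4
        · simp [inh, g, if_neg hv]
    intro p
    rw [RingHom.coe_coe, hε]
    rw [← Ideal.Quotient.eq]
    have : (Ideal.Quotient.mk I : MvPolynomial V k →+* MvPolynomial V k ⧸ I) = (Ideal.Quotient.mk I).comp (ε : MvPolynomial V k →+* MvPolynomial V k) := by
      refine MvPolynomial.ringHom_ext (fun a => ?_) (fun v => ?_)
      · simp [ε]
      · exact Ideal.Quotient.eq.2 (key v)
    exact congrArg (fun f => f p) this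

end Triangular

end

end NSFDA

namespace NSFDA

noncomputable section

open MvPolynomial

/-! ### Iterated derivatives of differential polynomials -/

@[simp]
theorem pd_X (j α : Fin 4) (M : Fin 4 → ℕ) :
    pd j (X (α, M)) = X (α, M + Pi.single j 1) := by
  simp [pd, mkDerivation_X]

theorem pd_comm (i j : Fin 4) (f : DiffPoly) : pd i (pd j f) = pd j (pd i f) := by
  have h : ⁅pd i, pd j⁆ = 0 := by
    refine derivation_ext fun v => ?_
    obtain ⟨α, M⟩ := v
    simp [Derivation.commutator_apply, add_right_comm]
  have := congrArg (fun d => d f) h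
  simpa [Derivation.commutator_apply, sub_eq_zero] using this

/-- `∂_j` as an endomorphism of the vector space of differential polynomials. -/
def pdEnd (j : Fin 4) : Module.End KRe DiffPoly := (pd j).toLinearMap

theorem pdEnd_commute (i j : Fin 4) : Commute (pdEnd i) (pdEnd j) :=
  LinearMap.ext fun f => pd_comm i j f

/-- The iterated derivative `∂^N`. -/
def pdN (N : Fin 4 → ℕ) : Module.End KRe DiffPoly :=
  pdEnd 0 ^ N 0 * pdEnd 1 ^ N 1 * pdEnd 2 ^ N 2 * pdEnd 3 ^ N 3

@[simp]
theorem pdN_zero (f : DiffPoly) : pdN 0 f = f := by simp [pdN]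

theorem pdN_add_single (N : Fin 4 → ℕ) (j : Fin 4) :
    pdN (N + Pi.single j 1) = pdEnd j * pdN N := by
  have c (i j : Fin 4) (n : ℕ) : pdEnd i ^ n * pdEnd j = pdEnd j * pdEnd i ^ n :=
    (pdEnd_commute i j).pow_left n
  have c' (i j : Fin 4) (n : ℕ) (x : Module.End KRe DiffPoly) :
      pdEnd i ^ n * (pdEnd j * x) = pdEnd j * (pdEnd i ^ n * x) := by
    rw [← mul_assoc, c, mul_assoc]
  fin_cases j <;>
  simp [pdN, pow_succ, mul_assoc, c, c']

theorem pdN_add_single_apply (N : Fin 4 → ℕ) (j : Fin 4) (f : DiffPoly) :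
    pdN (N + Pi.single j 1) f = pd j (pdN N f) := by
  rw [pdN_add_single]; rfl

theorem multiIndex_induction {P : (Fin 4 → ℕ) → Prop} (h0 : P 0)
    (hs : ∀ N j, P N → P (N + Pi.single j 1)) (N : Fin 4 → ℕ) : P N := by
  induction h : ∑ j, N j generalizing N with
  | zero =>
    have : N = 0 := by
      funext j
      simpa using (Finset.sum_eq_zero_iff.1 h) j (Finset.mem_univ j)
    rwa [this]
  | succ n ih =>
    obtain ⟨j, hj⟩ : ∃ j, N j ≠ 0 := by
      by_contra! hc
      simp [hc] at h
    have hN : N = (N - Pi.single j 1) + Pi.single j 1 := by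
      funext i
      by_cases hi : i = j
      · subst hi; simp; lia
      · simp [hi]
    rw [hN]
    refine hs _ j (ih _ ?_)
    have h2 := congrArg (fun N : Fin 4 → ℕ => ∑ j, N j) hN
    simp only [Pi.add_apply, Finset.sum_add_distrib, Finset.sum_pi_single', Finset.mem_univ,
      if_true] at h2
    lia

@[simp]
theorem pdN_X (N : Fin 4 → ℕ) (α : Fin 4) (M : Fin 4 → ℕ) :
    pdN N (X (α, M)) = X (α, M + N) := by
  induction N using multiIndex_induction with
  | h0 => simp
  | hs N j ih => rw [pdN_add_single_apply, ih, pd_X, add_assoc]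

/-- The divided power `∂^N / N!`. -/
def dpd (N : Fin 4 → ℕ) : Module.End KRe DiffPoly := (∏ j, ((N j).factorial : KRe))⁻¹ • pdN N

theorem dpd_add_single (N : Fin 4 → ℕ) (j : Fin 4) (f : DiffPoly) :
    ((N j + 1 : ℕ) : KRe) • dpd (N + Pi.single j 1) f = pd j (dpd N f) := by
  have h : ∏ i, (((N + Pi.single j 1 : Fin 4 → ℕ) i).factorial : KRe) =
      ((N j + 1 : ℕ) : KRe) * ∏ i, ((N i).factorial : KRe) := by
    rw [← Finset.mul_prod_erase _ _ (Finset.mem_univ j),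
      ← Finset.mul_prod_erase Finset.univ (fun i => ((N i).factorial : KRe)) (Finset.mem_univ j),
      ← mul_assoc]
    congr 1
    · simp [Nat.factorial_succ]
    · refine Finset.prod_congr rfl fun i hi => ?_
      simp [(Finset.mem_erase.1 hi).1]
  have hne : ((N j + 1 : ℕ) : KRe) ≠ 0 := by exact_mod_cast Nat.succ_ne_zero (N j)
  rw [dpd, dpd, LinearMap.smul_apply, LinearMap.smul_apply, pdN_add_single_apply, h, smul_smul,
    mul_inv, mul_inv_cancel_left₀ hne, Derivation.map_smul]

/-! ### Taylor expansion with a symbolic base point -/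

/-- Polynomials in grid coordinates `y` with coefficients in the differential polynomials. -/
abbrev JetPoly : Type := MvPolynomial (Fin 4) DiffPoly

/-- Evaluation at the grid point `y = θ`. -/
def evY (θ : Shift) : JetPoly →+* DiffPoly := eval fun j => C (θ j : KRe)

/-- The translation `y ↦ y + θ`. -/
def trY (θ : Shift) : JetPoly →+* JetPoly := eval₂Hom C fun j => X j + C (C (θ j : KRe))

theorem trY_injective (θ : Shift) : Function.Injective (trY θ) := by
  have h : (trY (-θ)).comp (trY θ) = RingHom.id JetPoly := by
    refine MvPolynomial.ringHom_ext (fun a => ?_) fun j => ?_ <;> simp [trY]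
  intro x y hxy
  have := congrArg (trY (-θ)) hxy
  simpa only [← RingHom.comp_apply, h, RingHom.id_apply] using this

/-- The derivation of `JetPoly` that acts as `∂_j` on the coefficients. -/
def pdY (j : Fin 4) : JetPoly →+ JetPoly where
  toFun p := AddMonoidAlgebra.map ((pd j).toLinearMap.toAddMonoidHom) p
  map_zero' := by simp
  map_add' p q := by simp [AddMonoidAlgebra.map_add]

@[simp]
theorem coeff_pdY (j : Fin 4) (p : JetPoly) (N : Fin 4 →₀ ℕ) :
    (pdY j p).coeff N = pd j (p.coeff N) := rfl

theorem pdY_mul (j : Fin 4) (p q : JetPoly) : pdY j (p * q) = pdY j p * q + p * pdY j q := by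
  ext1 N
  simp only [coeff_pdY, coeff_mul, coeff_add, map_sum, Derivation.leibniz, smul_eq_mul,
    ← Finset.sum_add_distrib]
  exact Finset.sum_congr rfl fun _ _ => by ring

theorem pdY_C_mul (j : Fin 4) (a : DiffPoly) (p : JetPoly) (hp : pdY j p = 0) :
    pdY j (C a * p) = C (pd j a) * p := by
  have : pdY j (C a) = C (pd j a) := by
    ext1 N
    simp only [coeff_pdY, coeff_C]
    split_ifs <;> simp
  rw [pdY_mul, hp, this, mul_zero, add_zero]

/-- `(y + θ)^N / N!`. -/
def divPow (θ : Shift) (N : Fin 4 → ℕ) : JetPoly :=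
  ∏ j, (C (C (((N j).factorial : KRe)⁻¹)) * (X j + C (C (θ j : KRe))) ^ N j)

theorem pdY_mul_eq_zero (j : Fin 4) (p q : JetPoly) (hp : pdY j p = 0) (hq : pdY j q = 0) :
    pdY j (p * q) = 0 := by
  rw [pdY_mul, hp, hq]; simp

theorem pdY_divPow (j : Fin 4) (θ : Shift) (N : Fin 4 → ℕ) : pdY j (divPow θ N) = 0 := by
  have hC (a : KRe) : pdY j (C (C a)) = 0 := by
    ext1 N
    simp only [coeff_pdY, coeff_C, coeff_zero]
    split_ifs <;> simp
  have h1 : pdY j 1 = 0 := by simpa using hC 1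
  have hpow (p : JetPoly) (hp : pdY j p = 0) (n : ℕ) : pdY j (p ^ n) = 0 := by
    induction n with
    | zero => simpa using h1
    | succ n ih => rw [pow_succ]; exact pdY_mul_eq_zero j _ _ ih hp
  have hX (i : Fin 4) : pdY j (X i) = 0 := by
    ext1 N
    simp only [coeff_pdY, coeff_X, coeff_zero]
    split_ifs <;> simp
  rw [divPow]
  refine Finset.prod_induction _ (fun p => pdY j p = 0) (pdY_mul_eq_zero j) h1 fun i _ => ?_
  refine pdY_mul_eq_zero j _ _ (hC _) (hpow _ ?_ _)
  rw [map_add, hX, hC, add_zero]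

theorem pderiv_divPow_add_single (j : Fin 4) (θ : Shift) (N : Fin 4 → ℕ) :
    pderiv j (divPow θ (N + Pi.single j 1)) = divPow θ N := by
  have hne : ((N j + 1 : ℕ) : KRe) ≠ 0 := by exact_mod_cast Nat.succ_ne_zero (N j)
  rw [divPow, divPow, ← Finset.mul_prod_erase _ _ (Finset.mem_univ j),
    ← Finset.mul_prod_erase Finset.univ _ (Finset.mem_univ j), Derivation.leibniz]
  have h0 : pderiv j (∏ i ∈ Finset.univ.erase j, (C (C ((((N + Pi.single j 1 : Fin 4 → ℕ) i).factorial : KRe)⁻¹)) *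
      (X i + C (C (θ i : KRe))) ^ (N + Pi.single j 1 : Fin 4 → ℕ) i) : JetPoly) = 0 := by
    refine Finset.prod_induction _ (fun p : JetPoly => pderiv j p = 0) (fun p q hp hq => ?_)
      (by simp) fun i hi => ?_
    · rw [Derivation.leibniz, hp, hq]; simp
    · simp [pderiv_X_of_ne (Finset.mem_erase.1 hi).1, Derivation.leibniz_pow, Derivation.leibniz]
  rw [h0, smul_zero, zero_add, smul_eq_mul, mul_comm]
  congr 1
  · have h1 : (C (C ((((N j + 1).factorial : ℕ) : KRe)⁻¹)) : JetPoly) * ((N j + 1 : ℕ) : JetPoly) =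
        C (C (((N j).factorial : KRe)⁻¹)) := by
      rw [← map_natCast (C : DiffPoly →+* JetPoly), ← map_natCast (C : KRe →+* DiffPoly),
        ← C_mul, ← C_mul]
      congr 2
      rw [Nat.factorial_succ, Nat.cast_mul, mul_inv, mul_comm, mul_inv_cancel_left₀ hne]
    simp only [Pi.add_apply, Pi.single_eq_same, Derivation.leibniz, Derivation.leibniz_pow,
      map_add, pderiv_C, pderiv_X_self, smul_eq_mul, add_zero, mul_one, mul_zero,
      Nat.add_sub_cancel, nsmul_eq_mul, ← h1]
    ring
  · refine Finset.prod_congr rfl fun i hi => ?_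
    simp [(Finset.mem_erase.1 hi).1]

theorem pderiv_divPow_of_eq_zero (j : Fin 4) (θ : Shift) (N : Fin 4 → ℕ) (h : N j = 0) :
    pderiv j (divPow θ N) = 0 := by
  refine Finset.prod_induction _ (fun p : JetPoly => pderiv j p = 0) (fun p q hp hq => ?_)
      (by simp) fun i _ => ?_
  · rw [Derivation.leibniz, hp, hq]; simp
  · by_cases hi : i = j
    · subst hi; simp [h]
    · simp [pderiv_X_of_ne hi, Derivation.leibniz_pow, Derivation.leibniz]

theorem evY_divPow (η θ : Shift) (N : Fin 4 → ℕ) :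
    evY η (divPow θ N) = C (∏ j, ((θ + η) j : KRe) ^ N j / ((N j).factorial : KRe)) := by
  simp only [divPow, map_prod]
  refine Finset.prod_congr rfl fun j _ => ?_
  simp [evY, div_eq_mul_inv, mul_comm, add_comm]

theorem trY_divPow (η θ : Shift) (N : Fin 4 → ℕ) :
    trY η (divPow θ N) = divPow (θ + η) N := by
  simp only [divPow, map_prod]
  refine Finset.prod_congr rfl fun j _ => ?_
  simp only [trY, map_mul, eval₂Hom_C, map_pow, map_add, eval₂Hom_X', Pi.add_apply, Int.cast_add]
  ring

/-- Taylor expansion of a grid variable about a symbolic grid point. -/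
def taylorYVar (v : Fin 4 × Shift) : PowerSeries JetPoly :=
  PowerSeries.mk fun k => ∑ N ∈ Finset.piAntidiag (Finset.univ : Finset (Fin 4)) k,
    C (X (v.1, N)) * divPow v.2 N

/-- Taylor expansion about the symbolic grid point `y`. -/
def taylorY : GridPoly →+* LaurentSeries JetPoly :=
  eval₂Hom ((lmap C).comp coeffExpansion) fun v => (taylorYVar v : LaurentSeries JetPoly)

theorem taylor_X (v : Fin 4 × Shift) : taylor (X v) = (taylorVar v : LaurentSeries DiffPoly) := by
  simp [taylor]

theorem taylorY_X (v : Fin 4 × Shift) :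
    taylorY (X v) = (taylorYVar v : LaurentSeries JetPoly) := by
  simp [taylorY]

theorem taylor_C (c : KReh) : taylor (C c) = coeffExpansion c := by
  simp [taylor]

theorem taylorY_C (c : KReh) : taylorY (C c) = lmap C (coeffExpansion c) := by
  simp [taylorY]

theorem shift_X (θ : Shift) (v : Fin 4 × Shift) : shift θ (X v) = X (v.1, v.2 + θ) := by
  simp [shift]

theorem shift_C (θ : Shift) (c : KReh) : shift θ (C c) = C c := by
  simp [shift]

/-! ### The symbolic expansion under evaluation, shifts and differentiation -/

theorem lmap_coe {A B : Type*} [CommRing A] [CommRing B] (f : A →+* B) (F : PowerSeries A) :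
    lmap f (F : LaurentSeries A) = (PowerSeries.map f F : LaurentSeries B) := by
  ext m
  rw [lmap_coeff, PowerSeries.coeff_coe, PowerSeries.coeff_coe]
  split_ifs <;> simp

/-- Moving the base point to θ and shifting by θ are the same operation; both are ring
homomorphisms, so comparison on the variables is enough. -/
theorem lmap_evY_taylorY (θ : Shift) (g : GridPoly) :
    lmap (evY θ) (taylorY g) = taylor (shift θ g) := by
  have h : (lmap (evY θ)).comp taylorY = taylor.comp (shift θ : GridPoly →+* GridPoly) := by
    refine MvPolynomial.ringHom_ext (fun c => ?_) fun v => ?_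
    · ext n
      simp [taylorY_C, taylor_C, evY]
    · simp only [RingHom.comp_apply, RingHom.coe_coe, taylorY_X, shift_X, taylor_X, lmap_coe]
      congr 1
      ext1 k
      simp only [PowerSeries.coeff_map, taylorYVar, taylorVar, PowerSeries.coeff_mk, map_sum,
        map_mul, evY_divPow]
      refine Finset.sum_congr rfl fun N _ => ?_
      rw [mul_comm]
      simp [evY]
  exact congrArg (fun f => f g) h

theorem taylorY_shift (θ : Shift) (g : GridPoly) :
    taylorY (shift θ g) = lmap (trY θ) (taylorY g) := by
  have h : taylorY.comp (shift θ : GridPoly →+* GridPoly) = (lmap (trY θ)).comp taylorY := by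
    refine MvPolynomial.ringHom_ext (fun c => ?_) fun v => ?_
    · ext1
      funext n
      simp [taylorY_C, trY]
    · simp only [RingHom.comp_apply, RingHom.coe_coe, taylorY_X, shift_X, lmap_coe]
      congr 1
      ext1 k
      simp only [PowerSeries.coeff_map, taylorYVar, PowerSeries.coeff_mk, map_sum,
        map_mul, trY_divPow]
      refine Finset.sum_congr rfl fun N _ => ?_
      simp [trY]
  exact congrArg (fun f => f g) h

theorem shift_zero (g : GridPoly) : shift 0 g = g := by
  simp only [shift, add_zero]
  exact rename_id_apply g

theorem lmap_evY_zero_taylorY (g : GridPoly) : lmap (evY 0) (taylorY g) = taylor g := by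
  rw [lmap_evY_taylorY, shift_zero]

/-- Reindexing N ↦ N + eⱼ matches the terms; those missed have Nⱼ = 0 and do not depend on yⱼ. -/
theorem pderiv_taylorYVar (j : Fin 4) (v : Fin 4 × Shift) (k : ℕ) :
    pderiv j (PowerSeries.coeff (k + 1) (taylorYVar v)) =
      pdY j (PowerSeries.coeff k (taylorYVar v)) := by
  simp only [taylorYVar, PowerSeries.coeff_mk, map_sum]
  symm
  refine Finset.sum_of_injOn (fun N => N + Pi.single j 1) (add_left_injective _).injOn ?_ ?_ ?_
  · intro N hN
    simp only [Finset.mem_coe, Finset.mem_piAntidiag, Pi.add_apply,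
      Finset.sum_add_distrib, Finset.sum_pi_single', Finset.mem_univ, if_true] at hN ⊢
    simp [hN.1]
  · intro N hN hN'
    have h0 : N j = 0 := by
      by_contra hne
      refine hN' ⟨N - Pi.single j 1, ?_, ?_⟩
      · have hN2 : N = (N - Pi.single j 1) + Pi.single j 1 := by
          funext i
          by_cases hi : i = j
          · subst hi; simp; lia
          · simp [hi]
        have h2 := congrArg (fun N : Fin 4 → ℕ => ∑ j, N j) hN2
        simp only [Pi.add_apply, Finset.sum_add_distrib, Finset.sum_pi_single', Finset.mem_univ,
          if_true] at h2
        have h3 := (Finset.mem_piAntidiag.1 hN).1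
        simp only [Finset.mem_coe, Finset.mem_piAntidiag, Finset.mem_univ, implies_true, and_true]
        lia
      · funext i
        by_cases hi : i = j
        · subst hi; simp; lia
        · simp [hi]
    simp [Derivation.leibniz, pderiv_divPow_of_eq_zero j _ N h0]
  · intro N _
    rw [pdY_C_mul j _ _ (pdY_divPow j _ N), pd_X, Derivation.leibniz, pderiv_C, smul_zero,
      add_zero, pderiv_divPow_add_single, smul_eq_mul]

/-- The chain rule: y counts grid cells, so a step in yⱼ is a step of length `h` in the j-th
coordinate. Both sides obey the Leibniz rule, which reduces the claim to variables. -/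
theorem pderiv_taylorY (j : Fin 4) (g : GridPoly) :
    lmapAdd (pderiv j : Derivation DiffPoly JetPoly JetPoly).toLinearMap.toAddMonoidHom (taylorY g)
      = HahnSeries.single 1 1 * lmapAdd (pdY j) (taylorY g) := by
  induction g using MvPolynomial.induction_on with
  | C c =>
    ext1
    funext n
    have (a : KRe) : pdY j (C (C a)) = 0 := by
      ext1 N
      simp only [coeff_pdY, coeff_C, coeff_zero]
      split_ifs <;> simp
    rw [lmapAdd_coeff, coeff_single_mul', lmapAdd_coeff, taylorY_C, lmap_coeff, lmap_coeff,
      coeffExpansion, RingHom.comp_apply, mapCoeff_coeff, mapCoeff_coeff, this]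
    simp
  | add p q hp hq => simp only [map_add, hp, hq, mul_add]
  | mul_X p v hp =>
    have hX : lmapAdd (pderiv j : Derivation DiffPoly JetPoly JetPoly).toLinearMap.toAddMonoidHom
        (taylorY (X v)) = HahnSeries.single 1 1 * lmapAdd (pdY j) (taylorY (X v)) := by
      ext1
      funext n
      rw [lmapAdd_coeff, coeff_single_mul', lmapAdd_coeff, taylorY_X, PowerSeries.coeff_coe,
        PowerSeries.coeff_coe]
      rcases lt_trichotomy n 0 with h | h | h
      · rw [if_pos h, if_pos (by lia)]; simp
      · subst h
        simp [taylorYVar, divPow]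
      · obtain ⟨k, rfl⟩ : ∃ k : ℕ, n = k + 1 := ⟨(n - 1).toNat, by lia⟩
        rw [if_neg (by lia), if_neg (by lia)]
        simpa using! pderiv_taylorYVar j v k
    rw [map_mul, lmapAdd_leibniz _ (fun a b => by simp [mul_comm, add_comm]), hp, hX,
      lmapAdd_leibniz _ (pdY_mul j)]
    ring

/-- The coefficient of `y^N` in the Taylor expansion is `h^|N| ∂^N / N!` of the expansion at the
base point. -/
theorem coeff_taylorY (g : GridPoly) (N : Fin 4 →₀ ℕ) (n : ℤ) :
    ((taylorY g).coeff n).coeff N = dpd N ((taylor g).coeff (n - ∑ j, (N j : ℤ))) := by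
  obtain ⟨N, rfl⟩ := Finsupp.equivFunOnFinite.symm.surjective N
  induction N using multiIndex_induction generalizing n with
  | h0 =>
    rw [← lmap_evY_zero_taylorY g, lmap_coeff]
    have h0 : Finsupp.equivFunOnFinite.symm (0 : Fin 4 → ℕ) = 0 := by ext; simp
    have : evY 0 = (constantCoeff : JetPoly →+* DiffPoly) := by
      refine MvPolynomial.ringHom_ext (fun a => ?_) fun j => ?_ <;> simp [evY]
    rw [this, h0]
    simp [dpd, constantCoeff_eq]
  | hs N j ih =>
    have hne : ((N j + 1 : ℕ) : KRe) ≠ 0 := by exact_mod_cast Nat.succ_ne_zero (N j)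
    have h1 := congrArg (fun F => (F.coeff n).coeff (Finsupp.equivFunOnFinite.symm N))
      (pderiv_taylorY j g)
    have h2 : Finsupp.equivFunOnFinite.symm (N + Pi.single j 1) =
        Finsupp.equivFunOnFinite.symm N + Finsupp.single j 1 := by
      ext i
      simp [Finsupp.single_apply, Pi.single_apply, eq_comm]
    simp only [lmapAdd_coeff, coeff_single_mul', coeff_pdY] at h1
    rw [ih] at h1
    have h3 := (coeff_pderiv ((taylorY g).coeff n) (Finsupp.equivFunOnFinite.symm N) (i := j))
    rw [← h2] at h3
    have h4 : ((N j + 1 : ℕ) : KRe) • ((taylorY g).coeff n).coeff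
        (Finsupp.equivFunOnFinite.symm (N + Pi.single j 1)) =
        coeff (Finsupp.equivFunOnFinite.symm N) (pderiv j ((taylorY g).coeff n)) := by
      rw [h3, mul_comm, Algebra.smul_def]
      simp
    have h5 : n - 1 - ∑ i, ((Finsupp.equivFunOnFinite.symm N i : ℕ) : ℤ) =
        n - ∑ i, ((Finsupp.equivFunOnFinite.symm (N + Pi.single j 1) i : ℕ) : ℤ) := by
      rw [h2]
      simp [Finset.sum_add_distrib, Finsupp.single_apply]
      ring
    rw [h5] at h1
    have h6 := dpd_add_single N j ((taylor g).coeff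
      (n - ∑ i, ((Finsupp.equivFunOnFinite.symm (N + Pi.single j 1) i : ℕ) : ℤ)))
    refine smul_right_injective DiffPoly hne ?_
    exact h4.trans (h1.trans h6.symm)

end

end NSFDA

namespace NSFDA

noncomputable section

open MvPolynomial
open scoped RatFunc

/-! ### Limits of difference polynomials -/

theorem tendsTo_iff {ft : GridPoly} {f : DiffPoly} :
    TendsTo ft f ↔ ∃ G : PowerSeries DiffPoly,
      taylor ft = (G : LaurentSeries DiffPoly) ∧ PowerSeries.coeff 0 G = f := by
  constructor
  · rintro ⟨h1, h2⟩
    obtain ⟨G, hG, hG'⟩ := exists_eq_single_mul (taylor ft) 0 h1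
    exact ⟨G, by simpa using hG, by rw [hG' 0]; simpa using h2⟩
  · rintro ⟨G, hG, rfl⟩
    refine ⟨fun n hn => ?_, ?_⟩
    · rw [hG, PowerSeries.coeff_coe, if_pos hn]
    · rw [hG, PowerSeries.coeff_coe, if_neg (by lia)]; simp

theorem TendsTo.add {ft gt : GridPoly} {f g : DiffPoly} (hf : TendsTo ft f) (hg : TendsTo gt g) :
    TendsTo (ft + gt) (f + g) := by
  obtain ⟨F, hF, rfl⟩ := tendsTo_iff.1 hf
  obtain ⟨G, hG, rfl⟩ := tendsTo_iff.1 hg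
  exact tendsTo_iff.2 ⟨F + G, by simp [hF, hG], by simp⟩

theorem TendsTo.sub {ft gt : GridPoly} {f g : DiffPoly} (hf : TendsTo ft f) (hg : TendsTo gt g) :
    TendsTo (ft - gt) (f - g) := by
  obtain ⟨F, hF, rfl⟩ := tendsTo_iff.1 hf
  obtain ⟨G, hG, rfl⟩ := tendsTo_iff.1 hg
  exact tendsTo_iff.2 ⟨F - G, by simp [hF, hG], by simp⟩

theorem TendsTo.mul {ft gt : GridPoly} {f g : DiffPoly} (hf : TendsTo ft f) (hg : TendsTo gt g) :
    TendsTo (ft * gt) (f * g) := by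
  obtain ⟨F, hF, rfl⟩ := tendsTo_iff.1 hf
  obtain ⟨G, hG, rfl⟩ := tendsTo_iff.1 hg
  exact tendsTo_iff.2 ⟨F * G, by simp [hF, hG], by simp⟩

theorem coeffExpansion_C (a : KRe) : coeffExpansion (RatFunc.C a) = HahnSeries.C (C a) := by
  have : algebraMap KReh (LaurentSeries KRe) (RatFunc.C a) = HahnSeries.C a := by
    rw [← RatFunc.algebraMap_C, ← IsScalarTower.algebraMap_apply]
    simp [Polynomial.algebraMap_hahnSeries_apply]
  ext1
  funext n
  rw [coeffExpansion, RingHom.comp_apply, this, mapCoeff_coeff, HahnSeries.C_apply,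
    HahnSeries.C_apply]
  by_cases h : n = 0
  · simp [h]
  · simp [HahnSeries.coeff_single_of_ne h]

theorem tendsTo_C (a : KRe) : TendsTo (C (RatFunc.C a)) (C a) :=
  tendsTo_iff.2 ⟨PowerSeries.C (C a), by rw [taylor_C, coeffExpansion_C, PowerSeries.coe_C],
    by simp⟩

theorem tendsTo_zero : TendsTo 0 0 := by
  simpa using tendsTo_C 0

theorem TendsTo.sum {ι : Type*} (s : Finset ι) {ft : ι → GridPoly} {f : ι → DiffPoly}
    (h : ∀ i ∈ s, TendsTo (ft i) (f i)) : TendsTo (∑ i ∈ s, ft i) (∑ i ∈ s, f i) := by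
  classical
  induction s using Finset.induction_on with
  | empty => simpa using tendsTo_zero
  | insert i s hi ih =>
    rw [Finset.sum_insert hi, Finset.sum_insert hi]
    exact (h i (Finset.mem_insert_self i s)).add
      (ih fun j hj => h j (Finset.mem_insert_of_mem hj))

theorem taylor_X_zero (α : Fin 4) : taylor (X (α, 0)) = HahnSeries.C (X (α, 0)) := by
  rw [taylor_X, ← PowerSeries.coe_C]
  congr 1
  ext1 k
  rw [taylorVar, PowerSeries.coeff_mk, PowerSeries.coeff_C]
  split_ifs with h
  · subst h; simp
  · refine Finset.sum_eq_zero fun N hN => ?_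
    obtain ⟨j, hj⟩ : ∃ j, N j ≠ 0 := by
      by_contra! hc
      have := (Finset.mem_piAntidiag.1 hN).1
      simp [hc] at this
      exact h this.symm
    rw [Finset.prod_eq_zero (Finset.mem_univ j)] <;> simp [hj]

theorem tendsTo_X (α : Fin 4) : TendsTo (X (α, 0)) (X (α, 0)) :=
  tendsTo_iff.2 ⟨PowerSeries.C (X (α, 0)), by rw [taylor_X_zero, PowerSeries.coe_C], by simp⟩

/-- The coefficient of y^N carries an extra h^|N|, so at order zero the symbolic expansion does not
depend on y. -/
theorem TendsTo.shift {ft : GridPoly} {f : DiffPoly} (h : TendsTo ft f) (θ : Shift) :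
    TendsTo (shift θ ft) f := by
  refine ⟨fun n hn => ?_, ?_⟩
  · have : (taylorY ft).coeff n = 0 := by
      ext1 N
      rw [coeff_taylorY, h.1 _ (by have : 0 ≤ ∑ j, (N j : ℤ) := by positivity
                                   lia)]
      simp
    rw [← lmap_evY_taylorY, lmap_coeff, this, map_zero]
  · have : (taylorY ft).coeff 0 = C f := by
      ext1 N
      rw [coeff_taylorY, coeff_C]
      split_ifs with hN
      · subst hN
        simp [dpd, h.2]
      · obtain ⟨j, hj⟩ : ∃ j, N j ≠ 0 := by
          by_contra! hc
          exact hN (by ext j; simp [hc])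
        have h1 : 0 < ∑ j, (N j : ℤ) :=
          Finset.sum_pos' (fun i _ => by positivity) ⟨j, Finset.mem_univ j, by lia⟩
        rw [h.1 _ (by lia), map_zero]
    rw [← lmap_evY_taylorY, lmap_coeff, this]
    simp [evY]

/-! ### Extension of `φ : R → R⟦h⟧` to jets -/

/-- The extension of `φ : R → R⟦h⟧` to polynomials in `y`. -/
def liftY (φ : DiffPoly →+* PowerSeries DiffPoly) : JetPoly →+* PowerSeries JetPoly :=
  eval₂Hom ((PowerSeries.map C).comp φ) fun j => PowerSeries.C (X j)

theorem coeff_liftY (φ : DiffPoly →+* PowerSeries DiffPoly) (p : JetPoly) (k : ℕ)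
    (N : Fin 4 →₀ ℕ) :
    (PowerSeries.coeff k (liftY φ p)).coeff N = PowerSeries.coeff k (φ (p.coeff N)) := by
  induction p using MvPolynomial.induction_on' with
  | monomial M a =>
    have h : liftY φ (monomial M a) =
        PowerSeries.map C (φ a) * PowerSeries.C (monomial M (1 : DiffPoly)) := by
      simp [liftY, Finsupp.prod, ← map_pow, ← map_prod, monomial_eq, -prod_X_pow_eq_monomial]
    rw [h, mul_comm, PowerSeries.coeff_C_mul, PowerSeries.coeff_map, mul_comm, C_mul_monomial,
      mul_one, coeff_monomial, coeff_monomial]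
    split_ifs <;> simp
  | add p q hp hq => simp [hp, hq]

theorem lmapAdd_coeff_hat_liftY (φ : DiffPoly →+* PowerSeries DiffPoly) (N : Fin 4 →₀ ℕ)
    (F : LaurentSeries JetPoly) :
    lmapAdd (coeffAddMonoidHom N) (hat (liftY φ) F) =
      hat φ (lmapAdd (coeffAddMonoidHom N) F) :=
  hat_naturality _ _ _ _ (fun p k => coeff_liftY φ p k N) F

theorem lmap_evY_hat_liftY (φ : DiffPoly →+* PowerSeries DiffPoly) (θ : Shift) (F : LaurentSeries JetPoly) :
    lmap (evY θ) (hat (liftY φ) F) = hat φ (lmap (evY θ) F) := by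
  have h : (PowerSeries.map (evY θ)).comp (liftY φ) = φ.comp (evY θ) := by
    refine MvPolynomial.ringHom_ext (fun a => ?_) fun j => ?_
    · ext1 k; simp [liftY, evY]
    · ext1 k
      simp [liftY, evY]
  refine hat_naturality (liftY φ) φ (evY θ).toAddMonoidHom (evY θ).toAddMonoidHom
    (fun p k => ?_) F
  simpa using congrArg (fun f => PowerSeries.coeff k (f p)) h

theorem lmap_trY_hat_liftY (φ : DiffPoly →+* PowerSeries DiffPoly) (θ : Shift) (F : LaurentSeries JetPoly) :
    lmap (trY θ) (hat (liftY φ) F) = hat (liftY φ) (lmap (trY θ) F) := by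
  have h : (PowerSeries.map (trY θ)).comp (liftY φ) = (liftY φ).comp (trY θ) := by
    refine MvPolynomial.ringHom_ext (fun a => ?_) fun j => ?_
    · ext1 k; simp [liftY, trY]
    · simp [liftY, trY]
      rw [← coe_eval₂Hom, map_intCast]
  refine hat_naturality (liftY φ) (liftY φ) (trY θ).toAddMonoidHom (trY θ).toAddMonoidHom
    (fun p k => ?_) F
  simpa using congrArg (fun f => PowerSeries.coeff k (f p)) h

/-- The extension fixes both `h` and ℚ(Re), hence all of ℚ(Re)((h)); this makes it compatible with
difference operators having coefficients in ℚ(Re, h). -/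
theorem hat_coeffExpansion (φ : DiffPoly →+* PowerSeries DiffPoly)
    (hφ : ∀ a, φ (C a) = PowerSeries.C (C a)) (c : KReh) :
    hat φ (coeffExpansion c) = coeffExpansion c := by
  set x := algebraMap KReh (LaurentSeries KRe) c with hx
  have h1 : hat (PowerSeries.C : KRe →+* PowerSeries KRe) x = x := by
    obtain ⟨n, hn⟩ := exists_coeff_bound x
    obtain ⟨G, hG, -⟩ := exists_eq_single_mul x n hn
    rw [hG, hat_single_mul]
    congr 2
    ext m
    rw [coeff_hatP, Finset.sum_eq_single (m, 0)]
    · simp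
    · rintro ⟨i, j⟩ hij hne
      have : j ≠ 0 := by
        rintro rfl
        simp only [Finset.HasAntidiagonal.mem_antidiagonal, add_zero] at hij
        exact hne (by rw [hij])
      simp [PowerSeries.coeff_C, this]
    · simp
  have h2 := hat_naturality (PowerSeries.C : KRe →+* PowerSeries KRe) φ
    (C : KRe →+* DiffPoly).toAddMonoidHom (C : KRe →+* DiffPoly).toAddMonoidHom
    (fun a k => by
      simp only [RingHom.toAddMonoidHom_eq_coe, AddMonoidHom.coe_coe, hφ, PowerSeries.coeff_C]
      split_ifs <;> simp) x
  rw [h1] at h2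
  exact h2.symm

theorem lmapAdd_coeff_taylorY (g : GridPoly) (N : Fin 4 →₀ ℕ) :
    lmapAdd (coeffAddMonoidHom N) (taylorY g) =
      HahnSeries.single (∑ j, (N j : ℤ)) 1 *
        (HahnSeries.C (C (∏ j, ((N j).factorial : KRe))⁻¹) *
          lmapAdd (pdN N).toAddMonoidHom (taylor g)) := by
  ext1
  funext n
  rw [coeff_single_mul', HahnSeries.C_mul_eq_smul, HahnSeries.coeff_smul, lmapAdd_coeff,
    lmapAdd_coeff]
  refine (coeff_taylorY g N n).trans ?_
  simp [dpd, smul_eq_C_mul]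

theorem laurent_jet_ext {F G : LaurentSeries JetPoly}
    (h : ∀ N, lmapAdd (coeffAddMonoidHom N) F = lmapAdd (coeffAddMonoidHom N) G) : F = G := by
  ext1
  funext n
  ext1 N
  exact congrArg (fun x => x.coeff n) (h N)

/-! ### Linear difference operators -/

theorem act_eq_sum (D : DiffOp) (f : GridPoly) :
    act D f = ∑ θ ∈ D.support, C (D θ) * shift θ f := rfl

/-- If `D` approximates `P` on the variables, then it does so on all difference polynomials. -/
theorem TendsTo.act {D : DiffOp} {q g₀ : DiffPoly} {g : GridPoly}
    (hD : TendsTo (act D (X (0, 0))) q) (hg : TendsTo g g₀) :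
    TendsTo (NSFDA.act D g) (aeval (fun v : Fin 4 × (Fin 4 → ℕ) => pdN v.2 g₀) q) := by
  obtain ⟨G, hG, rfl⟩ := tendsTo_iff.1 hg
  -- `Ξ` substitutes the expansion of `g`, with its derivatives, for every dependent variable. Hence
  -- the action of `D` on one variable determines its action on `g`.
  let Ξ : DiffPoly →+* PowerSeries DiffPoly := eval₂Hom (PowerSeries.C.comp C)
    fun v => PowerSeries.mk fun k => pdN v.2 (PowerSeries.coeff k G)
  have hΞC (a) : Ξ (C a) = PowerSeries.C (C a) := by simp [Ξ]
  have hΞX (α N) : Ξ (X (α, N)) = PowerSeries.mk fun k => pdN N (PowerSeries.coeff k G) := by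
    simp [Ξ]
  -- The y-coefficients of a symbolic expansion are scaled derivatives of the expansion at the base
  -- point, so they can be compared one multi-index at a time.
  have h1 : hat (liftY Ξ) (taylorY (X (0, 0))) = taylorY g := by
    refine laurent_jet_ext fun N => ?_
    rw [lmapAdd_coeff_hat_liftY, lmapAdd_coeff_taylorY, lmapAdd_coeff_taylorY, map_mul,
      hat_single_one, map_mul, hat_C, hΞC, PowerSeries.coe_C, taylor_X_zero]
    congr 2
    have h2 : lmapAdd (pdN N).toAddMonoidHom (HahnSeries.C (X (0, 0))) =
        HahnSeries.C (X (0, (N : Fin 4 → ℕ))) := by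
      ext1
      funext n
      rw [lmapAdd_coeff, HahnSeries.C_apply, HahnSeries.C_apply]
      by_cases h : n = 0
      · subst h; simp
      · simp [HahnSeries.coeff_single_of_ne h]
    rw [h2, hat_C, hΞX, hG]
    ext1
    funext n
    rw [lmapAdd_coeff, PowerSeries.coeff_coe, PowerSeries.coeff_coe]
    split_ifs <;> simp
  have h3 (θ) : hat Ξ (taylor (NSFDA.shift θ (X (0, 0)))) = taylor (NSFDA.shift θ g) := by
    rw [← lmap_evY_taylorY, ← lmap_evY_hat_liftY Ξ, h1, lmap_evY_taylorY]
  have h4 : taylor (NSFDA.act D g) = hat Ξ (taylor (NSFDA.act D (X (0, 0)))) := by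
    simp only [act_eq_sum, map_sum, map_mul, taylor_C, hat_coeffExpansion Ξ hΞC, h3]
  refine ⟨fun n hn => ?_, ?_⟩
  · rw [h4]
    exact hat_coeff_of_lt Ξ _ 0 hD.1 hn
  · rw [h4, hat_coeff_lead Ξ _ 0 hD.1, hD.2]
    have : ((PowerSeries.constantCoeff : PowerSeries DiffPoly →+* DiffPoly).comp Ξ) =
        (aeval (fun v : Fin 4 × (Fin 4 → ℕ) => pdN v.2 (PowerSeries.coeff 0 G)) :
          DiffPoly →ₐ[KRe] DiffPoly).toRingHom := by
      refine MvPolynomial.ringHom_ext (fun a => ?_) fun v => ?_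
      · simp [hΞC]
      · obtain ⟨α, N⟩ := v
        simp only [RingHom.comp_apply, hΞX]
        simp
    simpa using congrArg (fun f => f q) this

theorem Approximates.tendsTo_act {D : DiffOp} {i : Fin 4}
    (hD : Approximates D (fun f => pd i f)) {g : GridPoly} {g₀ : DiffPoly} (hg : TendsTo g g₀) :
    TendsTo (NSFDA.act D g) (pd i g₀) := by
  have := TendsTo.act (hD 0) hg
  simp only [pd_X, aeval_X] at this
  rw [zero_add, ← zero_add (Pi.single i 1), pdN_add_single_apply, pdN_zero] at this
  exact this

section Limits

variable {Dt : DiffOp} {D : Fin 3 → DiffOp} {L : DiffOp}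

theorem tendsTo_discreteMomentum (hDt : Approximates Dt (fun f => pd 0 f))
    (hD : ∀ i : Fin 3, Approximates (D i) (fun f => pd i.succ f))
    (hL : Approximates L (fun f => ∑ j : Fin 3, pd j.succ (pd j.succ f))) (i : Fin 3) :
    TendsTo (discreteMomentum Dt D L i) (momentum i) :=
  (((hDt _).add (.sum _ fun _ _ => (tendsTo_X _).mul (hD _ _))).add (hD _ _)).sub
    ((tendsTo_C _).mul (hL _))

theorem tendsTo_discreteContinuity
    (hD : ∀ i : Fin 3, Approximates (D i) (fun f => pd i.succ f)) :
    TendsTo (discreteContinuity D) continuity :=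
  .sum _ fun _ _ => hD _ _

theorem tendsTo_discretePoisson
    (hD : ∀ i : Fin 3, Approximates (D i) (fun f => pd i.succ f)) :
    TendsTo (discretePoisson D) poisson :=
  .add (.sum _ fun i _ => (hD i).tendsTo_act (hD i 0))
    (.sum _ fun i _ => (hD i).tendsTo_act (.sum _ fun _ _ => (tendsTo_X _).mul (hD _ _)))

end Limits

/-! ### A perfect difference ideal -/

/-- The evaluation of difference polynomials defined by `φ`. -/
def evalJet (φ : DiffPoly →+* PowerSeries DiffPoly) : GridPoly →+* LaurentSeries JetPoly :=
  (hat (liftY φ)).comp taylorY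

theorem evalJet_shift (φ : DiffPoly →+* PowerSeries DiffPoly) (θ : Shift) (g : GridPoly) :
    evalJet φ (shift θ g) = lmap (trY θ) (evalJet φ g) := by
  rw [evalJet, RingHom.comp_apply, RingHom.comp_apply, taylorY_shift, lmap_trY_hat_liftY φ]

theorem lmap_evY_evalJet (φ : DiffPoly →+* PowerSeries DiffPoly) (g : GridPoly) :
    lmap (evY 0) (evalJet φ g) = hat φ (taylor g) := by
  rw [evalJet, RingHom.comp_apply, lmap_evY_hat_liftY φ, lmap_evY_zero_taylorY]

/-- The coefficient of y^N is h^|N| / N! times the image of the N-th derivative, so the conditions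
at the base point on all derivatives control the whole jet. -/
theorem evalJet_eq_zero (φ : DiffPoly →+* PowerSeries DiffPoly) (g : GridPoly)
    (h : ∀ N, hat φ (lmapAdd (pdN N).toAddMonoidHom (taylor g)) = 0) : evalJet φ g = 0 := by
  refine laurent_jet_ext fun N => ?_
  rw [evalJet, RingHom.comp_apply, lmapAdd_coeff_hat_liftY, lmapAdd_coeff_taylorY, map_mul,
    map_mul, h, mul_zero, mul_zero, map_zero]

/-- Translation of y is invertible. The backward direction gives stability under shifts, the forward
one lets a shift be cancelled, as perfectness requires. -/
theorem evalJet_shift_eq_zero_iff (φ : DiffPoly →+* PowerSeries DiffPoly) (θ : Shift) (g : GridPoly) :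
    evalJet φ (shift θ g) = 0 ↔ evalJet φ g = 0 := by
  rw [evalJet_shift φ, map_eq_zero_iff _ (lmap_injective (trY_injective θ))]

theorem evalJet_act_eq_zero (φ : DiffPoly →+* PowerSeries DiffPoly) (D : DiffOp) {g : GridPoly}
    (hg : evalJet φ g = 0) : evalJet φ (act D g) = 0 := by
  rw [act_eq_sum, map_sum]
  refine Finset.sum_eq_zero fun θ _ => ?_
  rw [map_mul, (evalJet_shift_eq_zero_iff φ θ g).2 hg, mul_zero]

theorem shift_mem_diffRing {S : AddSubmonoid Shift} {θ : Shift} (hθ : θ ∈ S) {f : GridPoly}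
    (hf : f ∈ diffRing S) : shift θ f ∈ diffRing S := by
  rw [diffRing, supported_eq_adjoin_X] at hf
  induction hf using Algebra.adjoin_induction with
  | mem x hx =>
    obtain ⟨v, hv, rfl⟩ := hx
    rw [shift_X]
    exact X_mem_supported.2 (S.add_mem hv hθ)
  | algebraMap c => rw [AlgHom.commutes]; exact Subalgebra.algebraMap_mem _ c
  | add p q _ _ hp hq => rw [map_add]; exact add_mem hp hq
  | mul p q _ _ hp hq => rw [map_mul]; exact mul_mem hp hq

/-- Laurent series over the domain `JetPoly` form a domain: if a product of powers of shifts of f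
vanishes, some shift of f vanishes, and then f itself does. -/
theorem evalJet_eq_zero_of_mem_perfectIdeal (φ : DiffPoly →+* PowerSeries DiffPoly) {S : AddSubmonoid Shift} {F : Set GridPoly}
    (hF : ∀ f ∈ F, f ∈ diffRing S ∧ evalJet φ f = 0) {g : GridPoly} (hg : g ∈ perfectIdeal S F) :
    evalJet φ g = 0 := by
  let I : Submodule (diffRing S) GridPoly :=
    { carrier := {f | f ∈ diffRing S ∧ evalJet φ f = 0}
      zero_mem' := ⟨zero_mem _, map_zero _⟩
      add_mem' := fun ha hb => ⟨add_mem ha.1 hb.1, by rw [map_add, ha.2, hb.2, add_zero]⟩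
      smul_mem' := fun c f hf => by
        rw [Subalgebra.smul_def, smul_eq_mul]
        exact ⟨mul_mem c.2 hf.1, by rw [map_mul, hf.2, mul_zero]⟩ }
  have hI : IsPerfectIdeal S I :=
    { le := fun f hf => hf.1
      shift_mem := fun θ hθ f hf =>
        ⟨shift_mem_diffRing hθ hf.1, (evalJet_shift_eq_zero_iff φ θ f).2 hf.2⟩
      perfect := fun f hf s k _ h => by
        refine ⟨hf, ?_⟩
        have h2 := h.2
        rw [map_prod, Finset.prod_eq_zero_iff] at h2
        obtain ⟨θ, _, hθ⟩ := h2
        rw [map_pow] at hθ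
        exact (evalJet_shift_eq_zero_iff φ θ f).1 (by by_contra hne; exact pow_ne_zero _ hne hθ) }
  have : g ∈ I := (Submodule.mem_sInf.1 hg) I ⟨hI, hF⟩
  exact this.2

end

end NSFDA

namespace NSFDA

noncomputable section

open MvPolynomial
open scoped RatFunc

/-! ### Injectivity of Taylor expansion -/

/-- Lagrange interpolation: for each pair of distinct nodes, one linear factor in a coordinate that
separates them. -/
theorem exists_interpolation {k : Type*} [Field k] [CharZero k] (T : Finset Shift) :
    ∃ q : Shift → MvPolynomial (Fin 4) k, ∀ J ∈ T, ∀ J' ∈ T,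
      eval (fun j => (J' j : k)) (q J) = if J = J' then 1 else 0 := by
  classical
  have h (J J' : Shift) : ∃ i, J ≠ J' → J i ≠ J' i := by
    by_cases hJ : J = J'
    · exact ⟨0, fun h => absurd hJ h⟩
    · obtain ⟨i, hi⟩ := Function.ne_iff.1 hJ
      exact ⟨i, fun _ => hi⟩
  choose i hi using h
  refine ⟨fun J => ∏ J' ∈ T.erase J, (C ((J (i J J') : k) - (J' (i J J') : k))⁻¹ *
    (X (i J J') - C (J' (i J J') : k))), fun J _ J' hJ' => ?_⟩
  rw [map_prod]
  split_ifs with hJJ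
  · subst hJJ
    refine Finset.prod_eq_one fun J' h => ?_
    have hne : (J (i J J') : k) - (J' (i J J') : k) ≠ 0 := by
      rw [sub_ne_zero]
      exact_mod_cast hi J J' (Finset.mem_erase.1 h).1.symm
    simp [inv_mul_cancel₀ hne]
  · exact Finset.prod_eq_zero (Finset.mem_erase.2 ⟨fun h => hJJ h.symm, hJ'⟩) (by simp)

/-- Multi-indices with entries less than `d`. -/
def box (d : ℕ) : Finset (Fin 4 → ℕ) := Fintype.piFinset fun _ => Finset.range d

theorem mem_box {d : ℕ} {N : Fin 4 → ℕ} : N ∈ box d ↔ ∀ j, N j < d := by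
  simp [box]

/-- The Taylor coefficient `h^|N| J^N / N!`. -/
def taylorCoeff (J : Shift) (N : Fin 4 → ℕ) : KReh :=
  RatFunc.X ^ (∑ j, N j) * RatFunc.C (∏ j, (J j : KRe) ^ N j / ((N j).factorial : KRe))

theorem coeffExpansion_X : coeffExpansion RatFunc.X = HahnSeries.single 1 1 := by
  ext1
  funext n
  have : algebraMap KReh (LaurentSeries KRe) RatFunc.X = HahnSeries.single 1 1 := RatFunc.coe_X
  rw [coeffExpansion, RingHom.comp_apply, this, mapCoeff_coeff]
  by_cases h : n = 1
  · simp [h]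
  · simp [HahnSeries.coeff_single_of_ne h]

theorem coeffExpansion_taylorCoeff (J : Shift) (N : Fin 4 → ℕ) :
    coeffExpansion (taylorCoeff J N) = HahnSeries.single ((∑ j, N j : ℕ) : ℤ)
      (C (∏ j, (J j : KRe) ^ N j / ((N j).factorial : KRe))) := by
  rw [taylorCoeff, map_mul, map_pow, coeffExpansion_X, coeffExpansion_C, HahnSeries.single_pow,
    HahnSeries.C_apply, HahnSeries.single_mul_single]
  simp

/-- Taylor expansion truncated to `box d`, as a polynomial over `ℚ(Re, h)`. -/
def truncTaylor (d : ℕ) : GridPoly →ₐ[KReh] MvPolynomial (Fin 4 × (Fin 4 → ℕ)) KReh :=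
  aeval fun v => ∑ N ∈ box d, C (taylorCoeff v.2 N) * X (v.1, N)

/-- Expansion of the coefficients in `h`. -/
def expandCoeffs : MvPolynomial (Fin 4 × (Fin 4 → ℕ)) KReh →+* LaurentSeries DiffPoly :=
  eval₂Hom coeffExpansion fun v => HahnSeries.C (X v)

theorem coeff_expandCoeffs (p : MvPolynomial (Fin 4 × (Fin 4 → ℕ)) KReh) (n : ℤ)
    (m : (Fin 4 × (Fin 4 → ℕ)) →₀ ℕ) :
    ((expandCoeffs p).coeff n).coeff m =
      (algebraMap KReh (LaurentSeries KRe) (p.coeff m)).coeff n := by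
  induction p using MvPolynomial.induction_on' with
  | monomial l c =>
    have h : expandCoeffs (monomial l c) =
        HahnSeries.C (monomial l (1 : KRe)) * coeffExpansion c := by
      rw [expandCoeffs, coe_eval₂Hom, eval₂_monomial, mul_comm, monomial_eq]
      simp only [Finsupp.prod, map_one, one_mul, map_prod, map_pow]
    rw [h, HahnSeries.C_mul_eq_smul, HahnSeries.coeff_smul, coeffExpansion, RingHom.comp_apply,
      mapCoeff_coeff, smul_eq_mul, mul_comm, C_mul_monomial, mul_one, coeff_monomial,
      coeff_monomial]
    split_ifs <;> simp
  | add p q hp hq => simp [hp, hq]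

theorem expandCoeffs_injective : Function.Injective expandCoeffs := by
  rw [injective_iff_map_eq_zero]
  intro p hp
  ext1 m
  apply (algebraMap KReh (LaurentSeries KRe)).injective
  ext1
  funext n
  rw [← coeff_expandCoeffs, hp]
  simp

/-- Discarding all derivatives outside a finite box replaces Taylor series by polynomials over ℚ(Re,
h), where the expansion can be inverted by linear algebra. -/
theorem lmap_taylor_eq_expandCoeffs (d : ℕ) (g : GridPoly) :
    lmap (aeval fun v : Fin 4 × (Fin 4 → ℕ) => if v.2 ∈ box d then X v else 0 :
      DiffPoly →ₐ[KRe] DiffPoly).toRingHom (taylor g) = expandCoeffs (truncTaylor d g) := by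
  set ρ : DiffPoly →ₐ[KRe] DiffPoly :=
    aeval fun v : Fin 4 × (Fin 4 → ℕ) => if v.2 ∈ box d then X v else 0 with hρ
  have h : (lmap ρ.toRingHom).comp taylor =
      expandCoeffs.comp (truncTaylor d : GridPoly →+* MvPolynomial (Fin 4 × (Fin 4 → ℕ)) KReh) := by
    refine MvPolynomial.ringHom_ext (fun c => ?_) fun v => ?_
    · ext1
      funext n
      simp [taylor_C, truncTaylor, expandCoeffs, coeffExpansion, mapCoeff_coeff]
    · obtain ⟨α, J⟩ := v
      simp only [RingHom.comp_apply, taylor_X, lmap_coe, RingHom.coe_coe, truncTaylor, aeval_X,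
        map_sum, map_mul]
      have h1 (N : Fin 4 → ℕ) : expandCoeffs (C (taylorCoeff J N)) * expandCoeffs (X (α, N)) =
          HahnSeries.single ((∑ j, N j : ℕ) : ℤ)
            (C (∏ j, (J j : KRe) ^ N j / ((N j).factorial : KRe)) * X (α, N)) := by
        rw [expandCoeffs, eval₂Hom_C, eval₂Hom_X', coeffExpansion_taylorCoeff, HahnSeries.C_apply,
          HahnSeries.single_mul_single, add_zero]
      simp only [h1]
      ext1
      funext n
      rw [HahnSeries.coeff_sum, PowerSeries.coeff_coe]
      split_ifs with hn
      · refine (Finset.sum_eq_zero fun N _ => ?_).symm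
        have : (0 : ℤ) ≤ (∑ j, N j : ℕ) := Int.natCast_nonneg _
        exact HahnSeries.coeff_single_of_ne (by lia)
      · obtain ⟨k, rfl⟩ := Int.eq_ofNat_of_zero_le (not_lt.1 hn)
        simp only [Int.natAbs_natCast, PowerSeries.coeff_map, taylorVar, PowerSeries.coeff_mk,
          map_sum, map_mul]
        have h2 (N : Fin 4 → ℕ) (a : DiffPoly) :
            (HahnSeries.single ((∑ j, N j : ℕ) : ℤ) a).coeff (k : ℤ) =
              if ∑ j, N j = k then a else 0 := by
          split_ifs with hN
          · rw [hN]; simp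
          · exact HahnSeries.coeff_single_of_ne (by exact_mod_cast Ne.symm hN)
        simp only [h2]
        rw [← Finset.sum_filter]
        symm
        refine Finset.sum_subset_zero_on_sdiff (fun N hN => ?_) (fun N hN => ?_) fun N hN => ?_
        · simp [(Finset.mem_filter.1 hN).2]
        · have : N ∉ box d := fun hb => (Finset.mem_sdiff.1 hN).2
            (Finset.mem_filter.2 ⟨hb, (Finset.mem_piAntidiag.1 (Finset.mem_sdiff.1 hN).1).1⟩)
          simp [hρ, this]
        · simp [hρ, (Finset.mem_filter.1 hN).1]
  exact congrArg (fun f => f g) h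

/-- Only finitely many shifts occur in `g`. On these nodes the truncated expansion is a linear
substitution of Vandermonde type, and interpolation polynomials give a left inverse. -/
theorem taylor_injective : Function.Injective taylor := by
  classical
  rw [injective_iff_map_eq_zero]
  intro g hg
  let T : Finset Shift := g.vars.image Prod.snd
  obtain ⟨q, hq⟩ := exists_interpolation (k := KReh) T
  let d : ℕ := (T.sup fun J => (q J).totalDegree) + 1
  have hd (J) (hJ : J ∈ T) (m) (hm : m ∈ (q J).support) : (m : Fin 4 → ℕ) ∈ box d := by
    rw [mem_box]
    intro j
    have h1 := le_totalDegree hm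
    have h2 : (q J).totalDegree ≤ T.sup fun J => (q J).totalDegree :=
      Finset.le_sup (f := fun J => (q J).totalDegree) hJ
    have h3 : m j ≤ m.sum fun _ e => e := by
      rw [Finsupp.sum_fintype _ _ (by simp)]
      exact Finset.single_le_sum (f := fun i => m i) (fun _ _ => Nat.zero_le _) (Finset.mem_univ j)
    simp only [d]
    lia
  have h0 : truncTaylor d g = 0 := expandCoeffs_injective (by
    rw [← lmap_taylor_eq_expandCoeffs, hg, map_zero, map_zero])
  -- The weights h^(-|N|) N! cancel those of the Taylor coefficients, leaving the value at `J'` of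
  -- the interpolation polynomial for `J`.
  let ℓ : MvPolynomial (Fin 4 × (Fin 4 → ℕ)) KReh →ₐ[KReh] GridPoly := aeval fun v =>
    ∑ J ∈ T, C ((RatFunc.X ^ (∑ j, v.2 j))⁻¹ * (∏ j, ((v.2 j).factorial : KReh)) *
      (q J).coeff (Finsupp.equivFunOnFinite.symm v.2)) * X (v.1, J)
  have h1 : ℓ (truncTaylor d g) = g := by
    rw [truncTaylor, ← AlgHom.comp_apply, comp_aeval]
    conv_rhs => rw [← MvPolynomial.aeval_X_left_apply (R := KReh) g]
    refine aeval_eq_of_supported (s := {v | v.2 ∈ T}) (mem_supported.2 fun v hv => ?_) ?_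
    · exact Finset.mem_image_of_mem _ hv
    · rintro ⟨α, J'⟩ hJ'
      have hJ'' : J' ∈ T := hJ'
      have key (J) (hJ : J ∈ T) : ∑ N ∈ box d, taylorCoeff J' N *
          ((RatFunc.X ^ (∑ j, N j))⁻¹ * (∏ j, ((N j).factorial : KReh)) *
          (q J).coeff (Finsupp.equivFunOnFinite.symm N)) = if J = J' then 1 else 0 := by
        rw [← hq J hJ J' hJ'', eval_eq']
        symm
        refine Finset.sum_of_injOn (fun m => (m : Fin 4 → ℕ)) DFunLike.coe_injective.injOn
          (fun m hm => hd J hJ m hm) (fun N _ hN => ?_) fun m _ => ?_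
        · have : (q J).coeff (Finsupp.equivFunOnFinite.symm N) = 0 := by
            by_contra hne
            exact hN ⟨_, mem_support_iff.2 hne, by simp⟩
          rw [this, mul_zero, mul_zero]
        · have hX : (RatFunc.X : KReh) ^ (∑ j, m j) ≠ 0 := pow_ne_zero _ RatFunc.X_ne_zero
          have hf : (∏ j, ((m j).factorial : KReh)) ≠ 0 :=
            Finset.prod_ne_zero_iff.2 fun j _ => by exact_mod_cast Nat.factorial_ne_zero _
          have h5 : Finsupp.equivFunOnFinite.symm (m : Fin 4 → ℕ) = m := by ext; simp
          rw [h5, taylorCoeff]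
          simp only [map_prod, map_div₀, map_pow, map_intCast, map_natCast, Finset.prod_div_distrib]
          field_simp
      simp only [map_sum, map_mul, ℓ, aeval_X, aeval_C, algebraMap_eq, Finset.mul_sum]
      rw [Finset.sum_comm]
      simp only [← mul_assoc, ← C_mul, ← Finset.sum_mul, ← map_sum]
      simp only [← mul_assoc] at key
      rw [Finset.sum_congr rfl fun J hJ => by rw [key J hJ]]
      simp [hJ'']
  rw [← h1, h0, map_zero]

end

end NSFDA

namespace NSFDA

noncomputable section

open MvPolynomial

/-! ### Solving the discrete equations along the `x₁`-direction -/

/-- The momentum and continuity equations, indexed by the variable that they determine. -/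
def evolution : Fin 4 → DiffPoly := ![momentum 0, continuity, momentum 1, momentum 2]

/-- The `x₁`-order of the equations `evolution`. -/
def evolutionOrder : Fin 4 → ℕ := ![1, 1, 2, 2]

/-- The factors that normalize the equations `evolution`. -/
def evolutionUnit : Fin 4 → KRe := ![1, 1, -Re, -Re]

/-- A weight for which the equations `evolution` have the highest `x₁`-derivatives as leading
variables. -/
def evolutionWeight (v : Fin 4 × (Fin 4 → ℕ)) : ℕ := 3 * v.2 1 + (![5, 0, 1, 1] : Fin 4 → ℕ) v.1

theorem Re_ne_zero : Re ≠ 0 := RatFunc.X_ne_zero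

theorem evolutionUnit_ne_zero (α : Fin 4) : evolutionUnit α ≠ 0 := by
  fin_cases α <;> simp [evolutionUnit, Re_ne_zero]

/-- The offsets 5, 0, 1, 1 balance two demands: ∂₁p has weight 8, above the weight 6 of ∂₁²u₁, while
∂₂p and ∂₃p have weight 5, below the weight 7 of ∂₁²u₂ and ∂₁²u₃. In the continuity equation ∂₁u₁
has weight 3 against 1 for the other terms. -/
theorem evolution_sub_mem_supported (α : Fin 4) :
    C (evolutionUnit α) * evolution α - X (α, Pi.single 1 (evolutionOrder α)) ∈
      supported KRe {w | evolutionWeight w <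
        evolutionWeight (α, Pi.single 1 (evolutionOrder α))} := by
  have hRe : (C Re * C (1 / Re) : DiffPoly) = 1 := by
    rw [← C_mul, mul_one_div_cancel Re_ne_zero, C_1]
  have h2 : (Pi.single 1 1 + Pi.single 1 1 : Fin 4 → ℕ) = Pi.single 1 2 := by
    rw [← Pi.single_add]
  have hX {v : Fin 4 × (Fin 4 → ℕ)} {n : ℕ} (h : evolutionWeight v < n) :
      (X v : DiffPoly) ∈ supported KRe {w | evolutionWeight w < n} := X_mem_supported.2 h
  have hC (a : KRe) (n : ℕ) : (C a : DiffPoly) ∈ supported KRe {w | evolutionWeight w < n} :=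
    Subalgebra.algebraMap_mem _ a
  have s2 : (2 : Fin 3).succ = 3 := rfl
  fin_cases α
  all_goals
    simp only [evolutionUnit, evolution, evolutionOrder, Fin.reduceFinMk, Matrix.cons_val,
      Fin.zero_eta, Fin.mk_one, Fin.isValue, C_1, one_mul, momentum, continuity,
      Fin.sum_univ_three, pd_X, zero_add, Fin.succ_zero_eq_one, Fin.succ_one_eq_two, s2, h2,
      C_neg]
  · rw [show ∀ a b c d e f g : DiffPoly, a + b + c - d * (e + f + g) - c =
      a + b - d * (e + f + g) by intros; ring]
    refine sub_mem (add_mem (hX ?_) (add_mem (add_mem (mul_mem (hX ?_) (hX ?_))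
      (mul_mem (hX ?_) (hX ?_))) (mul_mem (hX ?_) (hX ?_))))
      (mul_mem (hC _ _) (add_mem (add_mem (hX ?_) (hX ?_)) (hX ?_)))
    all_goals simp [evolutionWeight]
  · rw [show ∀ a b c : DiffPoly, a + b + c - a = b + c by intros; ring]
    refine add_mem (hX ?_) (hX ?_)
    all_goals simp [evolutionWeight]
  -- The factor `-Re` makes the coefficient of the second x₁-derivative equal to 1, so that it
  -- cancels.
  · rw [show ∀ a b c d e f g : DiffPoly, -C Re * (a + b + c - d * (e + f + g)) - e =
      -C Re * (a + b + c - d * (f + g)) + (C Re * d - 1) * e by intros; ring, hRe, sub_self,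
      zero_mul, add_zero]
    refine mul_mem (neg_mem (hC _ _)) (sub_mem (add_mem (add_mem (hX ?_)
      (add_mem (add_mem (mul_mem (hX ?_) (hX ?_)) (mul_mem (hX ?_) (hX ?_)))
      (mul_mem (hX ?_) (hX ?_)))) (hX ?_)) (mul_mem (hC _ _) (add_mem (hX ?_) (hX ?_))))
    all_goals simp [evolutionWeight]
  · rw [show ∀ a b c d e f g : DiffPoly, -C Re * (a + b + c - d * (e + f + g)) - e =
      -C Re * (a + b + c - d * (f + g)) + (C Re * d - 1) * e by intros; ring, hRe, sub_self,
      zero_mul, add_zero]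
    refine mul_mem (neg_mem (hC _ _)) (sub_mem (add_mem (add_mem (hX ?_)
      (add_mem (add_mem (mul_mem (hX ?_) (hX ?_)) (mul_mem (hX ?_) (hX ?_)))
      (mul_mem (hX ?_) (hX ?_)))) (hX ?_)) (mul_mem (hC _ _) (add_mem (hX ?_) (hX ?_))))
    all_goals simp [evolutionWeight]

/-- Differentiation in x₁ raises every weight by 3 and other derivations preserve weights, so
differentiated equations stay triangular. -/
theorem pd_mem_supported (j : Fin 4) {p : DiffPoly} {n : ℕ}
    (hp : p ∈ supported KRe {w | evolutionWeight w < n}) :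
    pd j p ∈ supported KRe {w | evolutionWeight w < n + 3 * (Pi.single j 1 : Fin 4 → ℕ) 1} := by
  have hmono : supported KRe {w | evolutionWeight w < n} ≤
      supported KRe {w | evolutionWeight w < n + 3 * (Pi.single j 1 : Fin 4 → ℕ) 1} :=
    supported_mono fun w (hw : evolutionWeight w < n) => Nat.lt_add_right _ hw
  rw [supported_eq_adjoin_X] at hp
  induction hp using Algebra.adjoin_induction with
  | mem x hx =>
    obtain ⟨⟨α, M⟩, hv, rfl⟩ := hx
    rw [pd_X]
    refine X_mem_supported.2 ?_
    simp only [evolutionWeight, Set.mem_ofPred_eq, Pi.add_apply] at hv ⊢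
    lia
  | algebraMap c => rw [Derivation.map_algebraMap]; exact zero_mem _
  | add p q _ _ hp hq => rw [map_add]; exact add_mem hp hq
  | mul p q hp' hq' hp hq =>
    rw [← supported_eq_adjoin_X] at hp' hq'
    rw [Derivation.leibniz, smul_eq_mul, smul_eq_mul]
    exact add_mem (mul_mem (hmono hp') hq) (mul_mem (hmono hq') hp)

theorem pdN_mem_supported (N : Fin 4 → ℕ) {p : DiffPoly} {n : ℕ}
    (hp : p ∈ supported KRe {w | evolutionWeight w < n}) :
    pdN N p ∈ supported KRe {w | evolutionWeight w < n + 3 * N 1} := by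
  induction N using multiIndex_induction with
  | h0 => simpa using hp
  | hs N j ih =>
    rw [pdN_add_single_apply, Pi.add_apply, mul_add, ← add_assoc]
    exact pd_mem_supported j ih

/-- Any discretization of `evolution` has a solution in `R⟦h⟧` that is generic modulo `h`. -/
theorem exists_discrete_solution (G : Fin 4 → PowerSeries DiffPoly)
    (hG : ∀ α, PowerSeries.coeff 0 (G α) = evolution α) :
    ∃ φ : DiffPoly →+* PowerSeries DiffPoly,
      (∀ α N, hatP φ (PowerSeries.mk fun k => pdN N (PowerSeries.coeff k (G α))) = 0) ∧
      ∀ p, p - PowerSeries.coeff 0 (φ p) ∈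
        Ideal.span (Set.range fun v : Fin 4 × (Fin 4 → ℕ) => pdN v.2 (evolution v.1)) := by
  let E : Fin 4 → (Fin 4 → ℕ) → PowerSeries DiffPoly := fun α N =>
    PowerSeries.mk fun k => pdN N (PowerSeries.coeff k (G α))
  let e : Fin 4 → Fin 4 → ℕ := fun α => Pi.single 1 (evolutionOrder α)
  -- The determined variables are all derivatives of the leading ones. Each is the leading term of
  -- exactly one differentiated equation, with multi-index `v.2 - e v.1`.
  obtain ⟨φ, h1, h2, h3⟩ := exists_hensel_solution (k := KRe) evolutionWeight
    {v : Fin 4 × (Fin 4 → ℕ) | e v.1 ≤ v.2}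
    (fun v => PowerSeries.C (C (evolutionUnit v.1)) * E v.1 (v.2 - e v.1)) (by
      rintro ⟨α, M⟩ hM
      obtain ⟨N, rfl⟩ : ∃ N, M = e α + N := exists_add_of_le hM
      have h := pdN_mem_supported N (evolution_sub_mem_supported α)
      rw [map_sub, ← smul_eq_C_mul, map_smul, pdN_X, smul_eq_C_mul] at h
      simp only [PowerSeries.coeff_C_mul, E, PowerSeries.coeff_mk, hG, add_tsub_cancel_left]
      have hw : evolutionWeight (α, e α) + 3 * N 1 = evolutionWeight (α, e α + N) := by
        simp only [evolutionWeight, Pi.add_apply]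
        ring
      rw [← hw]
      exact h)
  refine ⟨φ, fun α N => ?_, fun p => ?_⟩
  · have := h1 (α, e α + N) (by simp)
    simp only [add_tsub_cancel_left, map_mul, hatP_C, h2] at this
    have h4 : PowerSeries.C (C (evolutionUnit α)⁻¹) * PowerSeries.C (C (evolutionUnit α)) =
        (1 : PowerSeries DiffPoly) := by
      rw [← map_mul, ← C_mul, inv_mul_cancel₀ (evolutionUnit_ne_zero α)]
      simp
    calc _ = 1 * hatP φ (E α N) := (one_mul _).symm
      _ = 0 := by rw [← h4, mul_assoc, this, mul_zero]
  · refine (Ideal.span_le.2 ?_) (h3 p)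
    rintro _ ⟨⟨α, M⟩, -, rfl⟩
    simp only [PowerSeries.coeff_C_mul, E, PowerSeries.coeff_mk, hG]
    exact Ideal.mul_mem_left _ _ (Ideal.subset_span ⟨(α, _), rfl⟩)

theorem pdN_mem_radicalDifferentialIdeal {F : Set DiffPoly} {f : DiffPoly} (hf : f ∈ F)
    (N : Fin 4 → ℕ) : pdN N f ∈ radicalDifferentialIdeal F := by
  refine (Submodule.mem_sInf).2 fun I hI => ?_
  induction N using multiIndex_induction with
  | h0 => rw [pdN_zero]; exact hI.2.2 hf
  | hs N j ih => rw [pdN_add_single_apply]; exact hI.2.1 j _ ih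

/-! ### Commutation of difference operators -/

theorem shift_shift (θ η : Shift) (f : GridPoly) : shift θ (shift η f) = shift (θ + η) f := by
  simp only [shift, rename_rename]
  congr 2
  funext v
  simp [add_assoc, add_comm η θ]

theorem act_add (D : DiffOp) (f g : GridPoly) : act D (f + g) = act D f + act D g := by
  simp [act_eq_sum, mul_add, Finset.sum_add_distrib]

theorem act_sub (D : DiffOp) (f g : GridPoly) : act D (f - g) = act D f - act D g := by
  simp [act_eq_sum, mul_sub, Finset.sum_sub_distrib]

theorem act_sum {ι : Type*} (D : DiffOp) (s : Finset ι) (f : ι → GridPoly) :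
    act D (∑ i ∈ s, f i) = ∑ i ∈ s, act D (f i) := by
  simp only [act_eq_sum, map_sum, Finset.mul_sum]
  exact Finset.sum_comm

theorem act_C_mul (D : DiffOp) (c : KReh) (f : GridPoly) : act D (C c * f) = C c * act D f := by
  simp only [act_eq_sum, map_mul, shift_C, Finset.mul_sum]
  exact Finset.sum_congr rfl fun _ _ => by ring

theorem shift_act (θ : Shift) (D : DiffOp) (f : GridPoly) :
    shift θ (act D f) = act D (shift θ f) := by
  simp only [act_eq_sum, map_sum, map_mul, shift_C, shift_shift, add_comm]

theorem act_comm (D E : DiffOp) (f : GridPoly) : act D (act E f) = act E (act D f) := by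
  rw [act_eq_sum E f, act_sum, act_eq_sum E (act D f)]
  exact Finset.sum_congr rfl fun θ _ => by rw [act_C_mul, shift_act]

/-- The integrability condition of the discrete Navier–Stokes equations. -/
theorem sum_act_discreteMomentum (Dt : DiffOp) (D : Fin 3 → DiffOp) (L : DiffOp) :
    ∑ i, act (D i) (discreteMomentum Dt D L i) =
      act Dt (discreteContinuity D) + discretePoisson D -
        C (RatFunc.C (1 / Re)) * act L (discreteContinuity D) := by
  have h (i : Fin 3) : act (D i) (discreteMomentum Dt D L i) =
      act Dt (act (D i) (X (i.succ, 0))) +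
        act (D i) (∑ j : Fin 3, X (j.succ, 0) * act (D j) (X (i.succ, 0))) +
        act (D i) (act (D i) (X (0, 0))) -
        C (RatFunc.C (1 / Re)) * act L (act (D i) (X (i.succ, 0))) := by
    -- Constant-coefficient operators commute, so each divergence term becomes an operator applied
    -- to the continuity equation.
    rw [discreteMomentum, act_sub, act_add, act_add, act_C_mul, act_comm (D i) Dt,
      act_comm (D i) L]
  rw [Finset.sum_congr rfl fun i _ => h i, Finset.sum_sub_distrib, Finset.sum_add_distrib,
    Finset.sum_add_distrib, discreteContinuity, discretePoisson, act_sum, act_sum, Finset.mul_sum]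
  ring

/-! ### Consistency -/

section Consistency

variable {Dt : DiffOp} {D : Fin 3 → DiffOp} {L : DiffOp}

/-- Only four equations are solved; the discrete Poisson equation is a combination of operators
applied to them, by the integrability condition, and these operators preserve vanishing of the jet.
-/
theorem exists_jet_solution (hDt : Approximates Dt (fun f => pd 0 f))
    (hD : ∀ i : Fin 3, Approximates (D i) (fun f => pd i.succ f))
    (hL : Approximates L (fun f => ∑ j : Fin 3, pd j.succ (pd j.succ f))) :
    ∃ φ : DiffPoly →+* PowerSeries DiffPoly,
      (∀ i, evalJet φ (discreteMomentum Dt D L i) = 0) ∧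
      evalJet φ (discreteContinuity D) = 0 ∧ evalJet φ (discretePoisson D) = 0 ∧
      ∀ p, p - PowerSeries.coeff 0 (φ p) ∈
        Ideal.span (Set.range fun v : Fin 4 × (Fin 4 → ℕ) => pdN v.2 (evolution v.1)) := by
  let ft : Fin 4 → GridPoly := ![discreteMomentum Dt D L 0, discreteContinuity D,
    discreteMomentum Dt D L 1, discreteMomentum Dt D L 2]
  have hft (α) : TendsTo (ft α) (evolution α) := by
    fin_cases α
    · exact tendsTo_discreteMomentum hDt hD hL 0
    · exact tendsTo_discreteContinuity hD
    · exact tendsTo_discreteMomentum hDt hD hL 1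
    · exact tendsTo_discreteMomentum hDt hD hL 2
  choose G hG hG0 using fun α => tendsTo_iff.1 (hft α)
  obtain ⟨φ, h1, h2⟩ := exists_discrete_solution G hG0
  have h3 (α) : evalJet φ (ft α) = 0 := by
    refine evalJet_eq_zero φ _ fun N => ?_
    have : lmapAdd (pdN N).toAddMonoidHom (taylor (ft α)) =
        ((PowerSeries.mk fun k => pdN N (PowerSeries.coeff k (G α)) : PowerSeries DiffPoly) :
          LaurentSeries DiffPoly) := by
      rw [hG]
      ext1
      funext n
      rw [lmapAdd_coeff, PowerSeries.coeff_coe, PowerSeries.coeff_coe]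
      split_ifs <;> simp
    rw [this, hat_coe, h1, PowerSeries.coe_zero]
  have h4 (i) : evalJet φ (discreteMomentum Dt D L i) = 0 := by
    fin_cases i
    exacts [h3 0, h3 2, h3 3]
  have h6 : evalJet φ (discreteContinuity D) = 0 := h3 1
  refine ⟨φ, h4, h6, ?_, h2⟩
  have h5 : discretePoisson D = ∑ i, act (D i) (discreteMomentum Dt D L i) -
      act Dt (discreteContinuity D) + C (RatFunc.C (1 / Re)) * act L (discreteContinuity D) := by
    rw [sum_act_discreteMomentum]; ring
  rw [h5, map_add, map_sub, map_sum, map_mul, evalJet_act_eq_zero φ Dt h6,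
    evalJet_act_eq_zero φ L h6, Finset.sum_eq_zero fun i _ => evalJet_act_eq_zero φ _ (h4 i)]
  simp

/-- A difference polynomial that vanishes on a solution generic modulo `h` implies a differential
polynomial vanishing on all continuous solutions. -/
theorem exists_implies_of_evalJet_eq_zero (φ : DiffPoly →+* PowerSeries DiffPoly)
    {I : Ideal DiffPoly} (hφ : ∀ p, p - PowerSeries.coeff 0 (φ p) ∈ I) {ft : GridPoly}
    (hft : evalJet φ ft = 0) : ∃ f ∈ I, Implies ft f := by
  by_cases h0 : ft = 0
  · refine ⟨0, zero_mem _, fun _ => h0, 1, one_ne_zero, 0, ?_⟩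
    simp [h0]
  have hT : taylor ft ≠ 0 := fun h => h0 (taylor_injective (by rw [h, map_zero]))
  set n := (taylor ft).order with hn
  have hlow : ∀ i < n, (taylor ft).coeff i = 0 := fun i hi =>
    HahnSeries.coeff_eq_zero_of_lt_order hi
  have hne : (taylor ft).coeff n ≠ 0 := HahnSeries.coeff_order_eq_zero.not.2 hT
  have hhat : hat φ (taylor ft) = 0 := by
    rw [← lmap_evY_evalJet φ, hft, map_zero]
  -- The factor h^|n| clears a possible pole and moves the order `n` to the non-negative exponent
  -- |n| + n.
  refine ⟨(taylor ft).coeff n, ?_, fun h => absurd h hne, Polynomial.X ^ n.natAbs,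
    pow_ne_zero _ Polynomial.X_ne_zero, (n.natAbs + n).toNat, ?_⟩
  -- The coefficient of hⁿ in the vanishing image is the constant term of `φ` at the leading
  -- coefficient; thus that constant term is zero and `hφ` gives membership in `I`.
  · have h1 := hat_coeff_lead φ _ n hlow
    rw [hhat] at h1
    have h2 := hφ ((taylor ft).coeff n)
    rwa [← h1, HahnSeries.coeff_zero, sub_zero] at h2
  · have h1 : taylor (C (algebraMap (Polynomial KRe) KReh (Polynomial.X ^ n.natAbs)) * ft) =
        HahnSeries.single (n.natAbs : ℤ) 1 * taylor ft := by
      rw [map_mul, taylor_C, map_pow, RatFunc.algebraMap_X, map_pow, coeffExpansion_X,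
        HahnSeries.single_pow]
      simp
    have h2 : (((n.natAbs + n).toNat : ℕ) : ℤ) = n.natAbs + n := Int.toNat_of_nonneg (by lia)
    simp only [h1, coeff_single_mul', h2]
    refine ⟨fun i hi => hlow _ (by lia), by congr 1; lia⟩

/-- The shifts are harmless: limits are shift invariant, and a shifted polynomial has zero jet
exactly when the original does. -/
theorem sConsistent_navierStokes (hDt : Approximates Dt (fun f => pd 0 f))
    (hD : ∀ i : Fin 3, Approximates (D i) (fun f => pd i.succ f))
    (hL : Approximates L (fun f => ∑ j : Fin 3, pd j.succ (pd j.succ f)))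
    (S : AddSubmonoid Shift) (a : Fin 3 → Shift) (b c : Shift)
    (ha : ∀ i, shift (a i) (discreteMomentum Dt D L i) ∈ diffRing S)
    (hb : shift b (discreteContinuity D) ∈ diffRing S)
    (hc : shift c (discretePoisson D) ∈ diffRing S) :
    SConsistent S
      ![shift (a 0) (discreteMomentum Dt D L 0), shift (a 1) (discreteMomentum Dt D L 1),
        shift (a 2) (discreteMomentum Dt D L 2), shift b (discreteContinuity D),
        shift c (discretePoisson D)]
      ![momentum 0, momentum 1, momentum 2, continuity, poisson] := by
  have hmem (j) : (![shift (a 0) (discreteMomentum Dt D L 0),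
      shift (a 1) (discreteMomentum Dt D L 1), shift (a 2) (discreteMomentum Dt D L 2),
      shift b (discreteContinuity D), shift c (discretePoisson D)] : Fin 5 → GridPoly) j ∈
      diffRing S := by
    fin_cases j
    exacts [ha 0, ha 1, ha 2, hb, hc]
  refine ⟨⟨hmem, fun j => ?_⟩, fun ft hft => ?_⟩
  · have hm := tendsTo_discreteMomentum hDt hD hL
    fin_cases j
    exacts [(hm 0).shift _, (hm 1).shift _, (hm 2).shift _, (tendsTo_discreteContinuity hD).shift _,
      (tendsTo_discretePoisson hD).shift _]
  · obtain ⟨φ, h1, h2, h3, h4⟩ := exists_jet_solution hDt hD hL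
    refine exists_implies_of_evalJet_eq_zero φ (fun p => ?_)
      (evalJet_eq_zero_of_mem_perfectIdeal φ ?_ hft)
    · refine (Ideal.span_le.2 ?_) (h4 p)
      rintro _ ⟨⟨α, N⟩, rfl⟩
      refine pdN_mem_radicalDifferentialIdeal ?_ N
      fin_cases α
      exacts [⟨0, rfl⟩, ⟨3, rfl⟩, ⟨1, rfl⟩, ⟨2, rfl⟩]
    · rintro _ ⟨j, rfl⟩
      refine ⟨hmem j, ?_⟩
      fin_cases j
      exacts [(evalJet_shift_eq_zero_iff φ _ _).2 (h1 0), (evalJet_shift_eq_zero_iff φ _ _).2 (h1 1),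
        (evalJet_shift_eq_zero_iff φ _ _).2 (h1 2), (evalJet_shift_eq_zero_iff φ _ _).2 h2,
        (evalJet_shift_eq_zero_iff φ _ _).2 h3]

end Consistency

end

end NSFDA

namespace NSFDA

noncomputable section

open MvPolynomial

/-! ### The ranking and leading monomials -/

/-- The ranking as a linear order: higher ranked variables have smaller keys. -/
def rankKey (v : Fin 4 × Shift) : (Lex Shift)ᵒᵈ ×ₗ Fin 4 :=
  toLex (OrderDual.toDual (toLex v.2), v.1)

theorem rankKey_injective : Function.Injective rankKey := by
  rintro ⟨a, b⟩ ⟨c, d⟩ h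
  have h1 := toLex.injective h
  simp only [Prod.mk.injEq] at h1
  rw [h1.2, toLex.injective (OrderDual.toDual.injective h1.1)]

theorem rankGT_iff {x y : Fin 4 × Shift} : RankGT x y ↔ rankKey x < rankKey y := by
  rw [rankKey, rankKey, Prod.Lex.toLex_lt_toLex, RankGT, OrderDual.toDual_lt_toDual]
  simp

theorem RankGT.trans {x y z : Fin 4 × Shift} (h : RankGT x y) (h' : RankGT y z) : RankGT x z :=
  rankGT_iff.2 ((rankGT_iff.1 h).trans (rankGT_iff.1 h'))

theorem not_rankGT_self (x : Fin 4 × Shift) : ¬ RankGT x x := fun h =>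
  lt_irrefl _ (rankGT_iff.1 h)

theorem rankGT_trichotomy (x y : Fin 4 × Shift) : RankGT x y ∨ x = y ∨ RankGT y x := by
  rw [rankGT_iff, rankGT_iff, ← rankKey_injective.eq_iff]
  exact lt_trichotomy _ _

theorem RankGT.shift {x y : Fin 4 × Shift} (h : RankGT x y) (θ : Shift) :
    RankGT (x.1, x.2 + θ) (y.1, y.2 + θ) := by
  rcases h with h | ⟨h, h'⟩
  · exact Or.inl (add_lt_add_left (α := Lex Shift) h (toLex θ))
  · exact Or.inr ⟨by simp [h], h'⟩

theorem rankGT_of_time_lt {x y : Fin 4 × Shift} (h : y.2 0 < x.2 0) : RankGT x y :=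
  Or.inl ⟨0, fun j hj => absurd hj (Fin.not_lt_zero j), h⟩

/-- The monomial ordering is the lexicographic order on exponents after transport along `rankKey` to
a linear order, so a maximum exists on the finite support. -/
theorem exists_isLeadingMonomial {f : GridPoly} (hf : f ≠ 0) : ∃ m, IsLeadingMonomial f m := by
  obtain ⟨m, hm, hmax⟩ := Finset.exists_max_image f.support
    (fun m => toLex (m.mapDomain rankKey)) (support_nonempty.2 hf)
  refine ⟨m, hm, fun m' hm' hne => ?_⟩
  have hlt : toLex (m'.mapDomain rankKey) < toLex (m.mapDomain rankKey) :=
    lt_of_le_of_ne (hmax m' hm') fun h =>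
      hne (Finsupp.mapDomain_injective rankKey_injective (toLex.injective h))
  obtain ⟨i, hi, hi'⟩ := Finsupp.Lex.lt_iff.1 hlt
  -- At the first difference the larger monomial has a positive exponent, hence the index comes from
  -- a variable.
  obtain ⟨x, rfl⟩ : i ∈ Set.range rankKey := by
    by_contra hx
    have h0 : (ofLex (toLex (m.mapDomain rankKey))) i = 0 := Finsupp.mapDomain_of_notMem_range _ _ hx
    rw [h0] at hi'
    exact Nat.not_lt_zero _ hi'
  have e (m : (Fin 4 × Shift) →₀ ℕ) (x) : (ofLex (toLex (m.mapDomain rankKey))) (rankKey x) = m x :=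
    Finsupp.mapDomain_apply rankKey_injective _ _
  refine ⟨x, fun y hy => ?_, ?_⟩
  · have := hi (rankKey y) (rankGT_iff.1 hy)
    rwa [e, e] at this
  · rwa [e, e] at hi'

/-- `p` is `c` times the variable `v` plus a polynomial in lower ranked variables. -/
def HasLead (c : KReh) (v : Fin 4 × Shift) (p : GridPoly) : Prop :=
  p - C c * X v ∈ supported KReh {w | RankGT v w}

theorem supported_rankGT_mono {v w : Fin 4 × Shift} (h : RankGT v w ∨ v = w) :
    supported KReh {x | RankGT w x} ≤ supported KReh {x | RankGT v x} := by
  refine supported_mono fun x (hx : RankGT w x) => ?_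
  rcases h with h | rfl
  exacts [h.trans hx, hx]

theorem HasLead.add {c : KReh} {v : Fin 4 × Shift} {p q : GridPoly} (hp : HasLead c v p)
    (hq : q ∈ supported KReh {w | RankGT v w}) : HasLead c v (p + q) := by
  have := add_mem hp hq
  rwa [show p - C c * X v + q = p + q - C c * X v by ring] at this

theorem HasLead.sum {ι : Type*} {s : Finset ι} {c : ι → KReh} {v : Fin 4 × Shift}
    {p : ι → GridPoly} (h : ∀ i ∈ s, HasLead (c i) v (p i)) :
    HasLead (∑ i ∈ s, c i) v (∑ i ∈ s, p i) := by
  have := sum_mem h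
  rwa [Finset.sum_sub_distrib, ← Finset.sum_mul, ← map_sum] at this

theorem shift_mem_supported {s t : Set (Fin 4 × Shift)} {θ : Shift}
    (h : ∀ v ∈ s, (v.1, v.2 + θ) ∈ t) {p : GridPoly} (hp : p ∈ supported KReh s) :
    shift θ p ∈ supported KReh t := by
  rw [supported_eq_adjoin_X] at hp
  induction hp using Algebra.adjoin_induction with
  | mem x hx =>
    obtain ⟨v, hv, rfl⟩ := hx
    rw [shift_X]
    exact X_mem_supported.2 (h v hv)
  | algebraMap c => rw [AlgHom.commutes]; exact Subalgebra.algebraMap_mem _ c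
  | add p q _ _ hp hq => rw [map_add]; exact add_mem hp hq
  | mul p q _ _ hp hq => rw [map_mul]; exact mul_mem hp hq

theorem HasLead.shift {c : KReh} {v : Fin 4 × Shift} {p : GridPoly} (h : HasLead c v p)
    (θ : Shift) : HasLead c (v.1, v.2 + θ) (NSFDA.shift θ p) := by
  have := shift_mem_supported (t := {w | RankGT (v.1, v.2 + θ) w}) (θ := θ)
    (fun w (hw : RankGT v w) => hw.shift θ) h
  rwa [map_sub, map_mul, shift_C, shift_X] at this

/-- Translations preserve the lexicographic order. The bound `μ` may lie outside the support of `D`: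
the coefficient is then 0 and only lower variables remain, which lets several operators share one
`μ`. -/
theorem HasLead.act {D : DiffOp} {c : KReh} {v : Fin 4 × Shift} {p : GridPoly}
    (h : HasLead c v p) {μ : Shift} (hμ : ∀ θ ∈ D.support, toLex θ ≤ toLex μ) :
    HasLead (D μ * c) (v.1, v.2 + μ) (act D p) := by
  classical
  have hr (θ : Shift) (hθ : θ ∈ D.support) (hne : θ ≠ μ) :
      RankGT (v.1, v.2 + μ) (v.1, v.2 + θ) := Or.inl <| by
    have : toLex θ < toLex μ := lt_of_le_of_ne (hμ θ hθ) fun h => hne (toLex.injective h)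
    exact add_lt_add_right (α := Lex Shift) this (toLex v.2)
  have hterm (θ : Shift) (hθ : θ ∈ D.support) : HasLead (if θ = μ then D μ * c else 0)
      (v.1, v.2 + μ) (C (D θ) * NSFDA.shift θ p) := by
    split_ifs with hθμ
    · subst hθμ
      have := mul_mem (Subalgebra.algebraMap_mem (supported KReh {w | RankGT (v.1, v.2 + θ) w})
        (D θ)) (h.shift θ)
      rw [HasLead, C_mul]
      rwa [algebraMap_eq, mul_sub, ← mul_assoc] at this
    · rw [HasLead, C_0, zero_mul, sub_zero]
      refine mul_mem (Subalgebra.algebraMap_mem _ (D θ)) ?_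
      have h1 := supported_rankGT_mono (Or.inl (hr θ hθ hθμ)) (h.shift θ)
      have h2 := add_mem h1 (mul_mem (Subalgebra.algebraMap_mem _ c)
        (X_mem_supported.2 (hr θ hθ hθμ)))
      rwa [algebraMap_eq, sub_add_cancel] at h2
  have := HasLead.sum hterm
  rw [act_eq_sum]
  convert this using 1
  rw [Finset.sum_ite_eq']
  split_ifs with hm
  · rfl
  · rw [Finsupp.notMem_support_iff.1 hm, zero_mul]

theorem act_mem_supported {D : DiffOp} {s t : Set (Fin 4 × Shift)}
    (h : ∀ θ ∈ D.support, ∀ v ∈ s, (v.1, v.2 + θ) ∈ t) {p : GridPoly}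
    (hp : p ∈ supported KReh s) : act D p ∈ supported KReh t := by
  rw [act_eq_sum]
  exact sum_mem fun θ hθ => mul_mem (Subalgebra.algebraMap_mem _ _)
    (shift_mem_supported (h θ hθ) hp)

theorem HasLead.isLeadingMonomial {c : KReh} (hc : c ≠ 0) {v : Fin 4 × Shift} {p : GridPoly}
    (h : HasLead c v p) : IsLeadingMonomial p (Finsupp.single v 1) := by
  classical
  set r := p - C c * X v with hr
  have hp : p = C c * X v + r := by rw [hr]; ring
  have hlow (m) (hm : m ∈ r.support) (y) (hy : ¬ RankGT v y) : m y = 0 := by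
    by_contra hne
    exact hy (mem_supported.1 h ((mem_vars_iff_mem_support y).2 ⟨m, hm, Finsupp.mem_support_iff.2 hne⟩))
  have hcoeff (m) : p.coeff m = (if Finsupp.single v 1 = m then c else 0) + r.coeff m := by
    rw [hp, coeff_add, coeff_C_mul, coeff_X]
    simp
  constructor
  · rw [mem_support_iff, hcoeff, if_pos rfl]
    have : r.coeff (Finsupp.single v 1) = 0 := by
      by_contra hne
      have := hlow _ (mem_support_iff.2 hne) v (not_rankGT_self v)
      simp at this
    rwa [this, add_zero]
  · intro m' hm' hne
    rw [mem_support_iff, hcoeff, if_neg hne.symm, zero_add] at hm'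
    refine ⟨v, fun y hy => ?_, ?_⟩
    · rw [hlow m' (mem_support_iff.2 hm') y fun h => not_rankGT_self _ (hy.trans h),
        Finsupp.single_apply, if_neg]
      rintro rfl
      exact not_rankGT_self _ hy
    · rw [hlow m' (mem_support_iff.2 hm') v (not_rankGT_self v)]
      simp

/-! ### Ideals generated by polynomials with distinct linear leading monomials -/

theorem aeval_mem_supported {V W k : Type*} [CommRing k] {s : Set V} {t : Set W}
    {x : V → MvPolynomial W k} (hx : ∀ v ∈ s, x v ∈ supported k t) {p : MvPolynomial V k}
    (hp : p ∈ supported k s) : aeval x p ∈ supported k t := by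
  rw [supported_eq_adjoin_X] at hp
  induction hp using Algebra.adjoin_induction with
  | mem y hy =>
    obtain ⟨v, hv, rfl⟩ := hy
    rw [aeval_X]
    exact hx v hv
  | algebraMap c => rw [AlgHom.commutes]; exact Subalgebra.algebraMap_mem _ c
  | add p q _ _ hp hq => rw [map_add]; exact add_mem hp hq
  | mul p q _ _ hp hq => rw [map_mul]; exact mul_mem hp hq

theorem degreeOf_eq_zero_of_mem_supported {V k : Type*} [CommRing k] {s : Set V}
    {p : MvPolynomial V k} (hp : p ∈ supported k s) {x : V} (hx : x ∉ s) : degreeOf x p = 0 := by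
  classical
  rw [degreeOf_def, Multiset.count_eq_zero]
  intro h
  exact hx (mem_supported.1 hp (by rw [Finset.mem_coe, vars_def]; exact Multiset.mem_toFinset.2 h))

/-- The ranking on integer shifts is not well-founded. Here every step of a descending chain must
start in the finite set `A`, so chains terminate. -/
theorem wellFounded_restrict {V : Type*} {gt : V → V → Prop} (hirr : ∀ v, ¬ gt v v)
    (htrans : ∀ u v w, gt u v → gt v w → gt u w) {A : Set V} (hA : A.Finite) :
    WellFounded fun w v => gt v w ∧ v ∈ A := by
  have h : ∀ (B : Finset V) (v : V), (∀ w ∈ A, gt v w → w ∈ B) →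
      Acc (fun w v => gt v w ∧ v ∈ A) v := by
    classical
    intro B
    induction B using Finset.strongInduction with
    | H B ih =>
      intro v hv
      refine ⟨v, fun w hw => ?_⟩
      by_cases hwA : w ∈ A
      · refine ih (B.erase w) (Finset.erase_ssubset (hv w hwA hw.1)) w fun u hu hwu => ?_
        refine Finset.mem_erase.2 ⟨?_, hv u hu (htrans _ _ _ hw.1 hwu)⟩
        rintro rfl
        exact hirr _ hwu
      · exact ⟨w, fun u hu => absurd hu.2 hwA⟩
  exact ⟨fun v => h hA.toFinset v fun w hw _ => hA.mem_toFinset.2 hw⟩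

/-- The leading monomial of an element of an ideal generated by finitely many polynomials with
distinct linear leading monomials is divisible by one of these. -/
theorem exists_lead_of_mem_span {ι : Type*} (A : Finset ι) (lead : ι → Fin 4 × Shift)
    (hinj : Set.InjOn lead A) (c : ι → KReh) (e : ι → GridPoly) (hc : ∀ a ∈ A, c a ≠ 0)
    (he : ∀ a ∈ A, HasLead (c a) (lead a) (e a)) {f : GridPoly}
    (hf : f ∈ Ideal.span (e '' A)) {m : (Fin 4 × Shift) →₀ ℕ} (hm : IsLeadingMonomial f m) :
    ∃ a ∈ A, m (lead a) ≠ 0 := by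
  classical
  -- Otherwise `m` involves no leading variable, and eliminating the leading variables from `f`
  -- leaves the coefficient of `m` intact although `f` becomes 0.
  by_contra! hfree
  let ρ : ι → GridPoly := fun a => C (-(c a)⁻¹) * (e a - C (c a) * X (lead a))
  let g : Fin 4 × Shift → GridPoly := fun v => ∑ a ∈ A with lead a = v, ρ a
  have hglead (a) (ha : a ∈ A) : g (lead a) = ρ a := by
    have : (A.filter fun b => lead b = lead a) = {a} := by
      ext b
      simp only [Finset.mem_filter, Finset.mem_singleton]
      exact ⟨fun h => hinj h.1 ha h.2, by rintro rfl; exact ⟨ha, rfl⟩⟩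
    simp only [g, this, Finset.sum_singleton]
  have hρ (a) (ha : a ∈ A) : ρ a ∈ supported KReh {w | RankGT (lead a) w} :=
    mul_mem (Subalgebra.algebraMap_mem _ _) (he a ha)
  have hgfree (v) (hv : v ∉ lead '' A) : g v = 0 := by
    refine Finset.sum_eq_zero fun a ha => absurd ?_ hv
    exact ⟨a, (Finset.mem_filter.1 ha).1, (Finset.mem_filter.1 ha).2⟩
  have hg (v) : g v ∈ supported KReh {w | RankGT v w ∧ v ∈ lead '' (A : Set ι)} := by
    by_cases hv : v ∈ lead '' (A : Set ι)
    · obtain ⟨a, ha, rfl⟩ := hv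
      rw [hglead a ha]
      refine supported_mono ?_ (hρ a ha)
      exact fun w hw => ⟨hw, a, ha, rfl⟩
    · rw [hgfree v hv]; exact zero_mem _
  have hwf := wellFounded_restrict (gt := RankGT) not_rankGT_self (fun _ _ _ h h' => h.trans h')
    (A.finite_toSet.image lead)
  -- The substitution solves each generator for its leading variable and fixes the other variables.
  obtain ⟨S, hS⟩ := exists_triangular_solution (C := GridPoly) hwf g hg
    (fun v => if v ∈ lead '' (A : Set ι) then 0 else X v)
  have hSfree (v) (hv : v ∉ lead '' (A : Set ι)) : S v = X v := by
    rw [hS, if_neg hv, hgfree v hv, map_zero, add_zero]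
  have hSsupp (v) : S v ∈ supported KReh {w | w = v ∨ RankGT v w} := by
    induction v using hwf.induction with
    | _ v ih =>
      by_cases hv : v ∈ lead '' (A : Set ι)
      · rw [hS, if_pos hv, zero_add]
        refine aeval_mem_supported (fun w hw => ?_) (hg v)
        refine supported_mono (fun u hu => ?_) (ih w hw)
        rcases hu with rfl | hu
        exacts [Or.inr hw.1, Or.inr (hw.1.trans hu)]
      · rw [hSfree v hv]
        exact X_mem_supported.2 (Or.inl rfl)
  have hker (a) (ha : a ∈ A) : aeval S (e a) = 0 := by
    have h1 := hS (lead a)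
    rw [if_pos ⟨a, ha, rfl⟩, zero_add, hglead a ha] at h1
    simp only [ρ, map_mul, map_sub, aeval_C, aeval_X, algebraMap_eq] at h1
    have h2 : (C (c a) * C (-(c a)⁻¹) : GridPoly) = -1 := by
      rw [← C_mul, mul_neg, mul_inv_cancel₀ (hc a ha), C_neg, C_1]
    linear_combination C (c a) * h1 + (aeval S (e a) - C (c a) * S (lead a)) * h2
  have hf0 : aeval S f = 0 := by
    have : Ideal.span (e '' A) ≤ RingHom.ker (aeval S : GridPoly →ₐ[KReh] GridPoly) := by
      rw [Ideal.span_le]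
      rintro _ ⟨a, ha, rfl⟩
      exact hker a ha
    exact this hf
  have hm0 : f.coeff m = 0 := by
    have h1 := congrArg (coeff m) hf0
    rw [aeval_def, eval₂_eq, coeff_sum, coeff_zero, Finset.sum_eq_single_of_mem m hm.1] at h1
    · have h2 : ∏ i ∈ m.support, S i ^ m i = monomial m 1 := by
        rw [monomial_eq, C_1, one_mul]
        refine Finset.prod_congr rfl fun v hv => ?_
        rw [hSfree]
        rintro ⟨a, ha, rfl⟩
        exact Finsupp.mem_support_iff.1 hv (hfree a ha)
      rwa [h2, algebraMap_eq, coeff_C_mul, coeff_monomial, if_pos rfl, mul_one] at h1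
    · intro m' hm' hne
      -- No other monomial contributes to `m`. Above `x` the two monomials agree, so the variables
      -- there are free and stay fixed; variables below `x` are replaced by polynomials without `x`.
      -- Thus the degree in `x` stays at most `m' x < m x`.
      obtain ⟨x, hx, hlt⟩ := hm.2 m' hm' hne
      have hxfree : x ∉ lead '' (A : Set ι) := by
        rintro ⟨a, ha, rfl⟩
        rw [hfree a ha] at hlt
        exact Nat.not_lt_zero _ hlt
      have hdeg : degreeOf x (∏ i ∈ m'.support, S i ^ m' i) ≤ m' x := by
        refine (degreeOf_prod_le x _ _).trans ?_
        refine (Finset.sum_le_sum (g := fun v => if v = x then m' x else 0) fun v hv => ?_).trans ?_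
        · refine (degreeOf_pow_le x _ _).trans ?_
          split_ifs with hvx
          · subst hvx
            rw [hSfree v hxfree, degreeOf_X_self, mul_one]
          · have : degreeOf x (S v) = 0 := by
              rcases rankGT_trichotomy v x with h | h | h
              · rw [hSfree, degreeOf_X_of_ne (Ne.symm hvx)]
                rintro ⟨a, ha, rfl⟩
                have := hx _ h
                rw [hfree a ha] at this
                exact Finsupp.mem_support_iff.1 hv this
              · exact absurd h hvx
              · refine degreeOf_eq_zero_of_mem_supported (hSsupp v) ?_
                rintro (h' | h')
                · exact hvx h'.symm
                · exact not_rankGT_self _ (h.trans h')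
            rw [this, mul_zero]
        · rw [Finset.sum_ite_eq']
          split_ifs <;> simp
      rw [algebraMap_eq, coeff_C_mul]
      have : coeff m (∏ i ∈ m'.support, S i ^ m' i) = 0 := by
        by_contra h
        have := monomial_le_degreeOf x (mem_support_iff.2 h)
        lia
      rw [this, mul_zero]
  exact (mem_support_iff.1 hm.1) hm0

/-! ### Sums of squares in `ℚ(Re, h)` -/

/-- If all degrees are at most n, the coefficient at degree 2n is the sum of squares of the
coefficients at n. These vanish, so the degree bound descends. -/
theorem polynomial_eq_zero_of_sum_mul_self {k ι : Type*} [Field k] [Fintype ι]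
    (hk : ∀ a : ι → k, ∑ i, a i * a i = 0 → ∀ i, a i = 0) (p : ι → Polynomial k)
    (h : ∑ i, p i * p i = 0) (i : ι) : p i = 0 := by
  have key (n : ℕ) : (∀ i, (p i).degree < n) → ∀ i, p i = 0 := by
    induction n with
    | zero =>
      intro hn i
      exact Polynomial.degree_eq_bot.1 (Nat.WithBot.lt_zero_iff.1 (hn i))
    | succ n ih =>
      intro hn
      refine ih fun i => ?_
      have hdeg (i) : (p i).natDegree ≤ n :=
        Polynomial.natDegree_le_iff_coeff_eq_zero.2 fun N hN =>
          (Polynomial.degree_lt_iff_coeff_zero _ _).1 (hn i) N hN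
      have h1 := congrArg (fun q => Polynomial.coeff q (n + n)) h
      simp only [Polynomial.finsetSum_coeff, Polynomial.coeff_zero] at h1
      have h2 := hk (fun i => (p i).coeff n) (by
        rw [← h1]
        exact Finset.sum_congr rfl fun i _ =>
          (Polynomial.coeff_mul_add_eq_of_natDegree_le (hdeg i) (hdeg i)).symm) i
      refine lt_of_le_of_ne (Polynomial.natDegree_le_iff_degree_le.1 (hdeg i)) fun h3 => ?_
      exact Polynomial.coeff_ne_zero_of_eq_degree h3 h2
  refine key ((Finset.univ.sup fun i => (p i).natDegree) + 1) (fun i => ?_) i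
  refine lt_of_le_of_lt Polynomial.degree_le_natDegree ?_
  exact_mod_cast Nat.lt_succ_of_le (Finset.le_sup (f := fun i => (p i).natDegree) (Finset.mem_univ i))

theorem ratFunc_eq_zero_of_sum_mul_self {k ι : Type*} [Field k] [Fintype ι]
    (hk : ∀ a : ι → k, ∑ i, a i * a i = 0 → ∀ i, a i = 0) (a : ι → RatFunc k)
    (h : ∑ i, a i * a i = 0) (i : ι) : a i = 0 := by
  obtain ⟨b, hb⟩ := IsLocalization.exist_integer_multiples (nonZeroDivisors (Polynomial k))
    Finset.univ a
  choose p hp using fun i => hb i (Finset.mem_univ i)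
  have hb0 : algebraMap (Polynomial k) (RatFunc k) b ≠ 0 := by
    simp
  have hp' (i) : algebraMap (Polynomial k) (RatFunc k) (p i) = algebraMap _ _ (b : Polynomial k) * a i := by
    rw [hp i, Algebra.smul_def]
  have h1 : ∑ i, p i * p i = 0 := by
    apply IsFractionRing.injective (Polynomial k) (RatFunc k)
    rw [map_sum, map_zero, ← mul_zero (algebraMap _ (RatFunc k) (b : Polynomial k) *
      algebraMap _ _ (b : Polynomial k)), ← h, Finset.mul_sum]
    refine Finset.sum_congr rfl fun i _ => ?_
    rw [map_mul, hp']
    ring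
  have h2 := polynomial_eq_zero_of_sum_mul_self hk p h1 i
  have h3 := hp' i
  rw [h2, map_zero] at h3
  exact (mul_eq_zero.1 h3.symm).resolve_left hb0

/-- Absence of non-trivial vanishing sums of squares passes from ℚ through two function fields. It
prevents cancellation of the leading coefficient of the discrete Poisson equation. -/
theorem eq_zero_of_sum_mul_self (a : Fin 3 → KReh) (h : ∑ i, a i * a i = 0) (i : Fin 3) :
    a i = 0 := by
  refine ratFunc_eq_zero_of_sum_mul_self (ratFunc_eq_zero_of_sum_mul_self fun a h i => ?_) a h i
  have := (Finset.sum_eq_zero_iff_of_nonneg fun i _ => mul_self_nonneg (a i)).1 h i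
    (Finset.mem_univ i)
  exact mul_self_eq_zero.1 this

end

end NSFDA

namespace NSFDA

noncomputable section

open MvPolynomial

/-! ### Difference ideals -/

section DifferenceIdeals

variable {S : AddSubmonoid Shift} {I : Submodule (diffRing S) GridPoly}

theorem IsDifferenceIdeal.C_mul_mem (c : KReh) {f : GridPoly} (hf : f ∈ I) : C c * f ∈ I :=
  I.smul_mem (⟨C c, Subalgebra.algebraMap_mem (diffRing S) c⟩ : diffRing S) hf

theorem IsDifferenceIdeal.act_mem (hI : IsDifferenceIdeal S I) {D : DiffOp}
    (hD : ∀ θ ∈ D.support, θ ∈ S) {f : GridPoly} (hf : f ∈ I) : act D f ∈ I := by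
  rw [act_eq_sum]
  exact sum_mem fun θ hθ => IsDifferenceIdeal.C_mul_mem _ (hI.shift_mem θ (hD θ hθ) f hf)

theorem act_mem_diffRing {D : DiffOp} (hD : ∀ θ ∈ D.support, θ ∈ S) {f : GridPoly}
    (hf : f ∈ diffRing S) : act D f ∈ diffRing S := by
  rw [act_eq_sum]
  exact sum_mem fun θ hθ => mul_mem (Subalgebra.algebraMap_mem _ _)
    (shift_mem_diffRing (hD θ hθ) hf)

end DifferenceIdeals

/-! ### The leading monomials of the discrete equations -/

section Leads

variable {Dt : DiffOp} {D : Fin 3 → DiffOp} {L : DiffOp}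

theorem act_X_mem_supported {D : DiffOp} {α : Fin 4} {J : Shift} {t : Set (Fin 4 × Shift)}
    (h : ∀ θ ∈ D.support, (α, J + θ) ∈ t) : act D (X (α, J)) ∈ supported KReh t := by
  refine act_mem_supported (s := {(α, J)}) (fun θ hθ v hv => ?_) (X_mem_supported.2 rfl)
  rw [Set.mem_singleton_iff] at hv
  rw [hv]
  exact h θ hθ

theorem hasLead_X (v : Fin 4 × Shift) : HasLead 1 v (X v) := by
  rw [HasLead, C_1, one_mul, sub_self]
  exact zero_mem _

/-- Only the time difference reaches positive times, and its latest shift outranks every spatial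
term. -/
theorem hasLead_discreteMomentum (hDt : ∀ θ ∈ Dt.support, ∀ i : Fin 3, θ i.succ = 0)
    (hD : ∀ i, ∀ θ ∈ (D i).support, θ 0 = 0) (hL : ∀ θ ∈ L.support, θ 0 = 0) {τ : Shift}
    (hτ : 0 < τ 0) (hmax : ∀ θ ∈ Dt.support, θ 0 ≤ τ 0) (hτD : τ ∈ Dt.support) (i : Fin 3) :
    HasLead (Dt τ) (i.succ, τ) (discreteMomentum Dt D L i) := by
  have h1 : HasLead (Dt τ) (i.succ, τ) (act Dt (X (i.succ, 0))) := by
    have := (hasLead_X (i.succ, 0)).act (D := Dt) (μ := τ) fun θ hθ => by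
      by_cases h : θ 0 = τ 0
      · refine le_of_eq (congrArg toLex (funext fun j => ?_))
        refine Fin.cases h (fun j => ?_) j
        rw [hDt θ hθ, hDt τ hτD]
      · exact le_of_lt ⟨0, fun j hj => absurd hj (Fin.not_lt_zero j),
          lt_of_le_of_ne (hmax θ hθ) h⟩
    simpa using this
  have hX (α : Fin 4) : (X (α, 0) : GridPoly) ∈ supported KReh {w | RankGT (i.succ, τ) w} :=
    X_mem_supported.2 (rankGT_of_time_lt (by simpa using hτ))
  have hact (E : DiffOp) (hE : ∀ θ ∈ E.support, θ 0 = 0) (α : Fin 4) :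
      act E (X (α, 0)) ∈ supported KReh {w | RankGT (i.succ, τ) w} :=
    act_X_mem_supported fun θ hθ => rankGT_of_time_lt (by simpa [hE θ hθ] using hτ)
  rw [discreteMomentum, sub_eq_add_neg]
  exact ((h1.add (sum_mem fun j _ => mul_mem (hX _) (hact _ (hD j) _))).add (hact _ (hD i) _)).add
    (neg_mem (mul_mem (Subalgebra.algebraMap_mem _ _) (hact _ hL _)))

theorem exists_hasLead_discreteContinuity (hD : ∃ i, ∃ θ ∈ (D i).support, 0 ≤ toLex θ) :
    ∃ (i : Fin 3) (μ : Shift), μ ∈ (D i).support ∧ 0 ≤ toLex μ ∧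
      (∀ j, ∀ θ ∈ (D j).support, toLex θ ≤ toLex μ) ∧
      HasLead (D i μ) (i.succ, μ) (discreteContinuity D) := by
  classical
  obtain ⟨i₀, θ₀, hθ₀, hpos⟩ := hD
  -- A minimal key means the highest rank. Maximizing over all three components at once gives a
  -- shift bounding every `D j`.
  obtain ⟨⟨i, μ⟩, hmem, hmin⟩ := Finset.exists_min_image
    (Finset.univ.sigma fun i => (D i).support)
    (fun p : (_ : Fin 3) × Shift => rankKey (p.1.succ, p.2)) ⟨⟨i₀, θ₀⟩, by simpa using hθ₀⟩
  have hμ : μ ∈ (D i).support := (Finset.mem_sigma.1 hmem).2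
  have hgt (j) (θ) (hθ : θ ∈ (D j).support) (hne : (j, θ) ≠ (i, μ)) :
      RankGT (i.succ, μ) (j.succ, θ) := by
    refine rankGT_iff.2 (lt_of_le_of_ne
      (hmin ⟨j, θ⟩ (Finset.mem_sigma.2 ⟨Finset.mem_univ _, hθ⟩)) fun h => hne ?_)
    have := rankKey_injective h
    simp only [Prod.mk.injEq, Fin.succ_inj] at this
    rw [this.1, this.2]
  have hle (j) (θ) (hθ : θ ∈ (D j).support) : toLex θ ≤ toLex μ := by
    by_cases h : (j, θ) = (i, μ)
    · rw [(Prod.mk.inj h).2]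
    · rcases hgt j θ hθ h with h | ⟨h, -⟩
      · exact le_of_lt h
      · exact le_of_eq (congrArg toLex (show μ = θ from h).symm)
  refine ⟨i, μ, hμ, hpos.trans (hle i₀ θ₀ hθ₀), hle, ?_⟩
  rw [discreteContinuity, ← Finset.add_sum_erase _ _ (Finset.mem_univ i)]
  have h1 := (hasLead_X (i.succ, 0)).act (D := D i) (hle i)
  rw [mul_one] at h1
  simp only [zero_add] at h1
  refine h1.add (sum_mem fun j hj => act_X_mem_supported fun θ hθ => ?_)
  rw [zero_add]
  exact hgt j θ hθ fun h => (Finset.mem_erase.1 hj).1 (Prod.mk.inj h).1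

/-- Velocities also occur at shifts up to 2μ, but at equal shift the pressure ranks higher.
Lexicographic non-negativity of `μ` keeps the unshifted factors of the convective term from
exceeding this bound. -/
theorem hasLead_discretePoisson {μ : Shift} (hμ : 0 ≤ toLex μ)
    (hD : ∀ j, ∀ θ ∈ (D j).support, toLex θ ≤ toLex μ) :
    HasLead (∑ i, D i μ * D i μ) (0, μ + μ) (discretePoisson D) := by
  have h1 : HasLead (∑ i, D i μ * D i μ) (0, μ + μ)
      (∑ i : Fin 3, act (D i) (act (D i) (X (0, 0)))) :=
    HasLead.sum fun i _ => by
      have := ((hasLead_X (0, 0)).act (hD i)).act (hD i)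
      simpa using this
  have hlt {j : Fin 3} {θ : Shift} (h : toLex θ ≤ toLex (μ + μ)) :
      RankGT (0, μ + μ) (j.succ, θ) := by
    rcases lt_or_eq_of_le h with h | h
    · exact Or.inl h
    · exact Or.inr ⟨(toLex.injective h).symm, Fin.succ_pos j⟩
  have hadd {θ η : Shift} (h : toLex θ ≤ toLex μ) (h' : toLex η ≤ toLex μ) :
      toLex (θ + η) ≤ toLex (μ + μ) := add_le_add (α := Lex Shift) h h'
  have hself {θ : Shift} (h : toLex θ ≤ toLex μ) : toLex (0 + θ) ≤ toLex (μ + μ) :=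
    hadd (θ := 0) hμ h
  refine h1.add (sum_mem fun i _ => ?_)
  refine act_mem_supported (s := {w | ∃ j : Fin 3, w.1 = j.succ ∧ toLex w.2 ≤ toLex μ}) ?_ ?_
  · rintro θ hθ ⟨_, η⟩ ⟨j, rfl, hη⟩
    exact hlt (hadd hη (hD i θ hθ))
  · refine sum_mem fun j _ => mul_mem (X_mem_supported.2 ⟨j, rfl, hμ⟩)
      (act_X_mem_supported fun θ hθ => ⟨i, rfl, ?_⟩)
    rw [zero_add]
    exact hD j θ hθ

end Leads

/-! ### The difference Gröbner basis -/

section Groebner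

variable {Dt : DiffOp} {D : Fin 3 → DiffOp} {L : DiffOp}

/-- The shifted integrability condition. -/
theorem shift_sum_act_discreteMomentum (σ : Shift) :
    ∑ θ ∈ Dt.support, C (Dt θ) * shift (σ + θ) (discreteContinuity D) =
      ∑ i, act (D i) (shift σ (discreteMomentum Dt D L i)) - shift σ (discretePoisson D) +
        C (RatFunc.C (1 / Re)) * act L (shift σ (discreteContinuity D)) := by
  have h := congrArg (shift σ) (sum_act_discreteMomentum Dt D L)
  have h1 : shift σ (act Dt (discreteContinuity D)) =
      ∑ θ ∈ Dt.support, C (Dt θ) * shift (σ + θ) (discreteContinuity D) := by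
    rw [act_eq_sum, map_sum]
    refine Finset.sum_congr rfl fun θ _ => ?_
    rw [map_mul, shift_C, shift_shift]
  simp only [map_sum, map_add, map_sub, map_mul, shift_C, h1] at h
  simp only [shift_act] at h
  rw [h]
  ring

/-- The leading variables of the equations are distinct if the continuity equation is shifted in
time by less than the leading variables of the momentum equations. -/
theorem injOn_leadingVariable {i : Fin 4} (hi : i ≠ 0) {ρ μ ν : Shift} (hμ : μ 0 = 0)
    {l : Fin 5 → Fin 4 × Shift} (hl : l = ![(1, ρ), (2, ρ), (3, ρ), (i, μ), (0, ν)]) :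
    Set.InjOn (fun a : Fin 5 × Shift => ((l a.1).1, (l a.1).2 + a.2))
      {a | 0 ≤ a.2 0 ∧ (a.1 = 3 → a.2 0 < ρ 0)} := by
  -- A collision with the continuity equation can only come from a momentum equation, since `i ≠ 0`;
  -- but that leading variable sits at time at least `ρ 0`, the other strictly earlier.
  have hkey (b : Fin 5) (hb : b ≠ 3) (θ θ' : Shift) (hθ : 0 ≤ θ 0) (hθ' : θ' 0 < ρ 0)
      (h1 : (l b).1 = i) (h2 : (l b).2 + θ = μ + θ') : False := by
    subst hl
    have h3 := congrFun h2 0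
    rw [Pi.add_apply, Pi.add_apply, hμ] at h3
    have h4 : ((![(1, ρ), (2, ρ), (3, ρ), (i, μ), (0, ν)] : Fin 5 → Fin 4 × Shift) b).2 = ρ := by
      fin_cases b
      exacts [rfl, rfl, rfl, absurd rfl hb, absurd h1.symm hi]
    rw [h4] at h3
    lia
  have hfst (b b' : Fin 5) (hb : b ≠ 3) (hb' : b' ≠ 3) (h : (l b).1 = (l b').1) : b = b' := by
    subst hl
    revert h hb hb'
    have key : ∀ b b' : Fin 5, b ≠ 3 → b' ≠ 3 →
        (![1, 2, 3, 0, 0] : Fin 5 → Fin 4) b = (![1, 2, 3, 0, 0] : Fin 5 → Fin 4) b' → b = b' := by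
      decide
    have hval : ∀ b : Fin 5, b ≠ 3 →
        ((![(1, ρ), (2, ρ), (3, ρ), (i, μ), (0, ν)] : Fin 5 → Fin 4 × Shift) b).1 =
          (![1, 2, 3, 0, 0] : Fin 5 → Fin 4) b := by
      intro b hb
      fin_cases b
      exacts [rfl, rfl, rfl, absurd rfl hb, rfl]
    intro hb hb' h
    rw [hval b hb, hval b' hb'] at h
    exact key b b' hb hb' h
  have h3 : l 3 = (i, μ) := by rw [hl]; rfl
  rintro ⟨b, θ⟩ ⟨hθ, hθ3⟩ ⟨b', θ'⟩ ⟨hθ', hθ3'⟩ h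
  obtain ⟨h1, h2⟩ := Prod.mk.inj h
  dsimp only at hθ hθ' hθ3 hθ3' h1 h2
  have hb : b = b' := by
    by_cases hb : b = 3
    · by_contra hne
      subst hb
      rw [h3] at h1 h2
      exact hkey b' (Ne.symm hne) θ' θ hθ' (hθ3 rfl) h1.symm h2.symm
    · by_cases hb' : b' = 3
      · subst hb'
        rw [h3] at h1 h2
        exact (hkey b hb θ θ' hθ (hθ3' rfl) h1 h2).elim
      · exact hfst b b' hb hb' h1
  subst hb
  rw [add_left_cancel h2]

/-- The integrability condition plays two roles: it puts the Poisson equation into the ideal, and it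
removes late time shifts of the continuity equation from the generators, leaving no coinciding
leading variables. -/
theorem isDifferenceGroebnerBasis_navierStokes
    (hDt : ∀ θ ∈ Dt.support, ∀ i : Fin 3, θ i.succ = 0)
    (hD : ∀ i, ∀ θ ∈ (D i).support, θ 0 = 0) (hL : ∀ θ ∈ L.support, θ 0 = 0)
    (hpos : ∃ θ ∈ Dt.support, 0 < θ 0) (hlex : ∃ i, ∃ θ ∈ (D i).support, 0 ≤ toLex θ)
    (S : AddSubmonoid Shift) (hS : S = nonnegShifts ∨ S = nonnegTimeShifts)
    (hDS : ∀ i, ∀ θ ∈ (D i).support, θ ∈ S) (hLS : ∀ θ ∈ L.support, θ ∈ S)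
    (s : ℕ) (hs : ∀ θ ∈ Dt.support, 0 ≤ θ 0 + s) :
    IsDifferenceGroebnerBasis S
      (Set.range ![shift (Pi.single 0 (s : ℤ)) (discreteMomentum Dt D L 0),
        shift (Pi.single 0 (s : ℤ)) (discreteMomentum Dt D L 1),
        shift (Pi.single 0 (s : ℤ)) (discreteMomentum Dt D L 2),
        discreteContinuity D])
      (Set.range ![shift (Pi.single 0 (s : ℤ)) (discreteMomentum Dt D L 0),
        shift (Pi.single 0 (s : ℤ)) (discreteMomentum Dt D L 1),
        shift (Pi.single 0 (s : ℤ)) (discreteMomentum Dt D L 2),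
        discreteContinuity D,
        shift (Pi.single 0 (s : ℤ)) (discretePoisson D)]) := by
  classical
  have hStime {θ : Shift} (h : θ ∈ S) : 0 ≤ θ 0 := by
    rcases hS with rfl | rfl
    exacts [h 0, h]
  -- Admissible shifts remain admissible when moved in time, as long as the time stays non-negative.
  -- This separates time from space for both choices of `S`.
  have hSsub {θ η : Shift} (h : θ ∈ S) (hη : ∀ i : Fin 3, η i.succ = 0) (hle : 0 ≤ θ 0 - η 0) :
      θ - η ∈ S := by
    rcases hS with rfl | rfl
    · refine fun j => Fin.cases hle (fun j => ?_) j
      rw [Pi.sub_apply, hη, sub_zero]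
      exact h j.succ
    · exact hle
  set σ : Shift := Pi.single 0 (s : ℤ) with hσ
  have hσ0 : σ 0 = s := by simp [hσ]
  have hσsucc (i : Fin 3) : σ i.succ = 0 := by simp [hσ]
  have hSt {η : Shift} (hη : ∀ i : Fin 3, η i.succ = 0) (hle : 0 ≤ η 0) : η ∈ S := by
    have := hSsub (θ := 0) (η := -η) S.zero_mem (fun i => by simp [hη]) (by simpa using hle)
    simpa using this
  have hσS : σ ∈ S := hSt hσsucc (by rw [hσ0]; exact Int.natCast_nonneg s)
  have hσDt {θ} (hθ : θ ∈ Dt.support) : σ + θ ∈ S :=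
    hSt (fun i => by rw [Pi.add_apply, hσsucc, hDt θ hθ, add_zero])
      (by rw [Pi.add_apply, hσ0, add_comm]; exact hs θ hθ)
  -- membership in the difference ring
  have hX (α : Fin 4) {J : Shift} (hJ : J ∈ S) : (X (α, J) : GridPoly) ∈ diffRing S :=
    X_mem_supported.2 hJ
  have hcont : discreteContinuity D ∈ diffRing S :=
    sum_mem fun i _ => act_mem_diffRing (hDS i) (hX _ S.zero_mem)
  have hpois : shift σ (discretePoisson D) ∈ diffRing S :=
    shift_mem_diffRing hσS (add_mem
      (sum_mem fun i _ => act_mem_diffRing (hDS i) (act_mem_diffRing (hDS i) (hX _ S.zero_mem)))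
      (sum_mem fun i _ => act_mem_diffRing (hDS i) (sum_mem fun j _ =>
        mul_mem (hX _ S.zero_mem) (act_mem_diffRing (hDS j) (hX _ S.zero_mem)))))
  have hmom (i) : shift σ (discreteMomentum Dt D L i) ∈ diffRing S := by
    have h1 : shift σ (act Dt (X (i.succ, 0))) ∈ diffRing S := by
      rw [act_eq_sum, map_sum]
      refine sum_mem fun θ hθ => ?_
      rw [map_mul, shift_C, shift_shift, shift_X, zero_add]
      exact mul_mem (Subalgebra.algebraMap_mem _ _) (hX _ (hσDt hθ))
    rw [discreteMomentum, add_assoc, add_sub_assoc, map_add]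
    exact add_mem h1 (shift_mem_diffRing hσS (sub_mem (add_mem (sum_mem fun j _ =>
      mul_mem (hX _ S.zero_mem) (act_mem_diffRing (hDS j) (hX _ S.zero_mem)))
      (act_mem_diffRing (hDS i) (hX _ S.zero_mem))) (mul_mem (Subalgebra.algebraMap_mem _ _)
      (act_mem_diffRing hLS (hX _ S.zero_mem)))))
  set F : Fin 4 → GridPoly := ![shift σ (discreteMomentum Dt D L 0),
    shift σ (discreteMomentum Dt D L 1), shift σ (discreteMomentum Dt D L 2),
    discreteContinuity D] with hF
  set G : Fin 5 → GridPoly := ![shift σ (discreteMomentum Dt D L 0),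
    shift σ (discreteMomentum Dt D L 1), shift σ (discreteMomentum Dt D L 2),
    discreteContinuity D, shift σ (discretePoisson D)] with hG
  have hGS (b) : G b ∈ diffRing S := by
    fin_cases b
    exacts [hmom 0, hmom 1, hmom 2, hcont, hpois]
  -- the two systems generate the same difference ideal
  have hideal (I : Submodule (diffRing S) GridPoly) (hI : IsDifferenceIdeal S I) :
      Set.range G ⊆ I ↔ Set.range F ⊆ I := by
    constructor
    · rintro h _ ⟨b, rfl⟩
      fin_cases b
      exacts [h ⟨0, rfl⟩, h ⟨1, rfl⟩, h ⟨2, rfl⟩, h ⟨3, rfl⟩]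
    · intro h
      have h3 : discreteContinuity D ∈ I := h ⟨3, rfl⟩
      have hm (i) : shift σ (discreteMomentum Dt D L i) ∈ I := by
        fin_cases i
        exacts [h ⟨0, rfl⟩, h ⟨1, rfl⟩, h ⟨2, rfl⟩]
      have h5 : shift σ (discretePoisson D) ∈ I := by
        have := shift_sum_act_discreteMomentum (Dt := Dt) (D := D) (L := L) σ
        rw [show shift σ (discretePoisson D) =
          ∑ i, act (D i) (shift σ (discreteMomentum Dt D L i)) +
          C (RatFunc.C (1 / Re)) * act L (shift σ (discreteContinuity D)) -
          ∑ θ ∈ Dt.support, C (Dt θ) * shift (σ + θ) (discreteContinuity D) by rw [this]; ring]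
        exact sub_mem (add_mem (sum_mem fun i _ => hI.act_mem (hDS i) (hm i))
          (IsDifferenceIdeal.C_mul_mem _ (hI.act_mem hLS (hI.shift_mem σ hσS _ h3))))
          (sum_mem fun θ hθ => IsDifferenceIdeal.C_mul_mem _ (hI.shift_mem _ (hσDt hθ) _ h3))
      rintro _ ⟨b, rfl⟩
      fin_cases b
      exacts [hm 0, hm 1, hm 2, h3, h5]
  refine ⟨?_, ?_, fun f hf hf0 => ?_⟩
  · rintro _ ⟨b, rfl⟩
    exact hGS b
  · refine congrArg sInf (Set.ext fun I => ?_)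
    exact and_congr_right fun hI => hideal I hI
  -- leading variables
  obtain ⟨τ, hτ, hmax⟩ := Finset.exists_max_image Dt.support (fun θ => θ 0)
    (hpos.imp fun θ h => h.1)
  have hτpos : 0 < τ 0 := by
    obtain ⟨θ, hθ, h⟩ := hpos
    exact h.trans_le (hmax θ hθ)
  obtain ⟨i₀, μ, hμ, hμ0, hμmax, hlead4⟩ := exists_hasLead_discreteContinuity hlex
  have hlead5 := hasLead_discretePoisson hμ0 hμmax
  have hleadm := hasLead_discreteMomentum hDt hD hL hτpos hmax hτ
  let c : Fin 5 → KReh := ![Dt τ, Dt τ, Dt τ, D i₀ μ, ∑ i, D i μ * D i μ]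
  let l : Fin 5 → Fin 4 × Shift :=
    ![(1, τ + σ), (2, τ + σ), (3, τ + σ), (i₀.succ, μ), (0, μ + μ + σ)]
  have hl (b) : HasLead (c b) (l b) (G b) := by
    fin_cases b
    exacts [(hleadm 0).shift σ, (hleadm 1).shift σ, (hleadm 2).shift σ, hlead4, hlead5.shift σ]
  have hc (b) : c b ≠ 0 := by
    have h1 : Dt τ ≠ 0 := Finsupp.mem_support_iff.1 hτ
    fin_cases b
    · exact h1
    · exact h1
    · exact h1
    · exact Finsupp.mem_support_iff.1 hμ
    -- A vanishing sum of squares would force `D i₀ μ = 0`, contrary to the choice of `μ`.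
    · intro h
      exact Finsupp.mem_support_iff.1 hμ (eq_zero_of_sum_mul_self (fun i => D i μ) h i₀)
  -- a generating system with distinct leading variables
  let A : Set (Fin 5 × Shift) := {a | a.2 ∈ S ∧ (a.1 = 3 → a.2 0 < s + τ 0)}
  let e : Fin 5 × Shift → GridPoly := fun a => shift a.2 (G a.1)
  -- Working in the full polynomial ring loses nothing: the leading-monomial statement needs only
  -- membership in `J`, and the indices in `A` keep the shifts in `S`.
  let J : Ideal GridPoly := Ideal.span (e '' A)
  have hne3 (b : Fin 5) (hb : b ≠ 3) {θ} (hθ : θ ∈ S) : shift θ (G b) ∈ J :=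
    Ideal.subset_span ⟨(b, θ), ⟨hθ, fun h => absurd h hb⟩, rfl⟩
  have hmomJ (i) {θ} (hθ : θ ∈ S) : shift θ (shift σ (discreteMomentum Dt D L i)) ∈ J := by
    fin_cases i
    exacts [hne3 0 (by decide) hθ, hne3 1 (by decide) hθ, hne3 2 (by decide) hθ]
  have hpoisJ {θ} (hθ : θ ∈ S) : shift θ (shift σ (discretePoisson D)) ∈ J :=
    hne3 4 (by decide) hθ
  -- Induction on a bound for the time shift. The integrability condition shifted by θ - (σ + τ)
  -- isolates the continuity equation at θ; its other occurrences there are strictly earlier.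
  have hcontJ : ∀ n : ℕ, ∀ θ ∈ S, θ 0 < n → shift θ (discreteContinuity D) ∈ J := by
    intro n
    induction n with
    | zero => intro θ hθ h; exact absurd (hStime hθ) (by simpa using h)
    | succ n ih =>
      intro θ hθ hn
      by_cases hlt : θ 0 < s + τ 0
      · exact Ideal.subset_span ⟨(3, θ), ⟨hθ, fun _ => hlt⟩, rfl⟩
      have hστ (i : Fin 3) : (σ + τ) i.succ = 0 := by
        rw [Pi.add_apply, hσsucc, hDt τ hτ, add_zero]
      have hστ0 : (σ + τ) 0 = s + τ 0 := by rw [Pi.add_apply, hσ0]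
      have hθ' : θ - (σ + τ) ∈ S := hSsub hθ hστ (by rw [hστ0]; lia)
      have hlow {η : Shift} (hη : η ∈ S) (h0 : η 0 < s + τ 0) :
          shift (θ - (σ + τ) + η) (discreteContinuity D) ∈ J := by
        refine ih _ (S.add_mem hθ' hη) ?_
        rw [Pi.add_apply, Pi.sub_apply, hστ0]
        push_cast at hn
        lia
      have h := congrArg (shift (θ - (σ + τ)))
        (shift_sum_act_discreteMomentum (Dt := Dt) (D := D) (L := L) σ)
      rw [← Finset.add_sum_erase _ _ hτ] at h
      simp only [map_add, map_sub, map_mul, map_sum, shift_C, shift_shift (θ - (σ + τ)) (σ + _),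
        sub_add_cancel] at h
      have h1 : C (Dt τ) * shift θ (discreteContinuity D) ∈ J := by
        rw [← eq_sub_iff_add_eq] at h
        rw [h]
        refine sub_mem (add_mem (sub_mem (sum_mem fun i _ => ?_) (hpoisJ hθ'))
          (Ideal.mul_mem_left _ _ ?_)) (sum_mem fun η hη => Ideal.mul_mem_left _ _ ?_)
        · rw [act_eq_sum, map_sum]
          refine sum_mem fun η hη => ?_
          rw [map_mul, shift_shift]
          exact Ideal.mul_mem_left _ _ (hmomJ i (S.add_mem hθ' (hDS i η hη)))
        · rw [act_eq_sum, map_sum]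
          refine sum_mem fun η hη => ?_
          rw [map_mul, shift_shift η σ, shift_shift]
          refine Ideal.mul_mem_left _ _ (hlow (S.add_mem (hLS η hη) hσS) ?_)
          rw [Pi.add_apply, hL η hη, hσ0]
          lia
        -- Shifts in the time difference are purely temporal, so one different from `τ` has strictly
        -- smaller time.
        · have hη' := Finset.mem_erase.1 hη
          refine hlow (hσDt hη'.2) ?_
          rw [Pi.add_apply, hσ0]
          have hle := hmax η hη'.2
          have hne : η 0 ≠ τ 0 := fun h0 => hη'.1 (funext fun j => by
            refine Fin.cases h0 (fun j => ?_) j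
            rw [hDt η hη'.2, hDt τ hτ])
          lia
      have h2 := Ideal.mul_mem_left J (C (Dt τ)⁻¹) h1
      rwa [← mul_assoc, ← C_mul, inv_mul_cancel₀ (Finsupp.mem_support_iff.1 hτ), C_1,
        one_mul] at h2
  have hGJ (b) {θ} (hθ : θ ∈ S) : shift θ (G b) ∈ J := by
    by_cases hb : b = 3
    · subst hb
      exact hcontJ ((θ 0).toNat + 1) θ hθ (by have := hStime hθ; push_cast; lia)
    · exact hne3 b hb hθ
  have hJshift {θ} (hθ : θ ∈ S) {p} (hp : p ∈ J) : shift θ p ∈ J := by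
    have : J ≤ J.comap (shift θ : GridPoly →+* GridPoly) := by
      refine Ideal.span_le.2 ?_
      rintro _ ⟨⟨b, η⟩, ⟨hη, -⟩, rfl⟩
      change shift θ (shift η (G b)) ∈ J
      rw [shift_shift]
      exact hGJ b (S.add_mem hθ hη)
    exact this hp
  have hfJ : f ∈ J := by
    let I : Submodule (diffRing S) GridPoly :=
      { carrier := {p | p ∈ diffRing S ∧ p ∈ J}
        zero_mem' := ⟨zero_mem _, zero_mem _⟩
        add_mem' := fun ha hb => ⟨add_mem ha.1 hb.1, add_mem ha.2 hb.2⟩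
        smul_mem' := fun r p hp => by
          rw [Subalgebra.smul_def, smul_eq_mul]
          exact ⟨mul_mem r.2 hp.1, Ideal.mul_mem_left _ _ hp.2⟩ }
    have hI : IsDifferenceIdeal S I :=
      { le := fun p hp => hp.1
        shift_mem := fun θ hθ p hp => ⟨shift_mem_diffRing hθ hp.1, hJshift hθ hp.2⟩ }
    have hFI : Set.range F ⊆ I := by
      refine (hideal I hI).1 ?_
      rintro _ ⟨b, rfl⟩
      refine ⟨hGS b, ?_⟩
      have := hGJ b S.zero_mem
      rwa [shift_zero] at this
    have : f ∈ I := (Submodule.mem_sInf.1 hf) I ⟨hI, hFI⟩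
    exact this.2
  -- Membership uses finitely many generators, and finiteness is what makes the elimination
  -- well-founded.
  obtain ⟨T, hTA, hfT⟩ := Submodule.mem_span_finite_of_mem_span hfJ
  obtain ⟨A', hA', rfl⟩ := Finset.subset_set_image_iff.1 hTA
  let lead : Fin 5 × Shift → Fin 4 × Shift := fun a => ((l a.1).1, (l a.1).2 + a.2)
  have hinj : Set.InjOn lead A := by
    refine (injOn_leadingVariable (l := l) (Fin.succ_ne_zero i₀) (hD i₀ μ hμ) rfl).mono ?_
    refine fun a ha => ⟨hStime ha.1, fun h => ?_⟩
    rw [Pi.add_apply, hσ0, add_comm]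
    exact ha.2 h
  obtain ⟨mf, hmf⟩ := exists_isLeadingMonomial hf0
  rw [Finset.coe_image] at hfT
  obtain ⟨⟨b, θ⟩, ha, hne⟩ := exists_lead_of_mem_span A' lead (hinj.mono hA') (fun a => c a.1) e
    (fun a _ => hc a.1) (fun a _ => (hl a.1).shift a.2) hfT hmf
  refine ⟨mf, hmf, G b, ⟨b, rfl⟩, Finsupp.single (l b) 1, (hl b).isLeadingMonomial (hc b), θ,
    (hA' ha).1, ?_⟩
  rw [shiftMon, Finsupp.mapDomain_single, Finsupp.single_le_iff]
  exact Nat.one_le_iff_ne_zero.2 hne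

end Groebner

end

end NSFDA

/-! ### The Gröbner basis and s-consistency statements combined -/

theorem mainTheorem4
    (Dt : DiffOp) (D : Fin 3 → DiffOp) (L : DiffOp)
    (hDt : Approximates Dt (fun f => pd 0 f))
    (hD : ∀ i : Fin 3, Approximates (D i) (fun f => pd i.succ f))
    (hL : Approximates L (fun f => ∑ j : Fin 3, pd j.succ (pd j.succ f))) :
    -- difference Gröbner basis
    ((∀ θ ∈ Dt.support, ∀ i : Fin 3, θ i.succ = 0) →
      (∀ i, ∀ θ ∈ (D i).support, θ 0 = 0) →
      (∀ θ ∈ L.support, θ 0 = 0) →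
      (∃ θ ∈ Dt.support, 0 < θ 0) →
      (∃ i, ∃ θ ∈ (D i).support, 0 ≤ toLex θ) →
      ∀ S : AddSubmonoid Shift, S = nonnegShifts ∨ S = nonnegTimeShifts →
      (∀ i, ∀ θ ∈ (D i).support, θ ∈ S) →
      (∀ θ ∈ L.support, θ ∈ S) →
      ∀ s : ℕ, (∀ θ ∈ Dt.support, 0 ≤ θ 0 + s) →
      IsDifferenceGroebnerBasis S
        (Set.range ![shift (Pi.single 0 (s : ℤ)) (discreteMomentum Dt D L 0),
          shift (Pi.single 0 (s : ℤ)) (discreteMomentum Dt D L 1),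
          shift (Pi.single 0 (s : ℤ)) (discreteMomentum Dt D L 2),
          discreteContinuity D])
        (Set.range ![shift (Pi.single 0 (s : ℤ)) (discreteMomentum Dt D L 0),
          shift (Pi.single 0 (s : ℤ)) (discreteMomentum Dt D L 1),
          shift (Pi.single 0 (s : ℤ)) (discreteMomentum Dt D L 2),
          discreteContinuity D,
          shift (Pi.single 0 (s : ℤ)) (discretePoisson D)])) ∧
    -- s-consistency
    (∀ (S : AddSubmonoid Shift) (a : Fin 3 → Shift) (b c : Shift),
      (∀ i, shift (a i) (discreteMomentum Dt D L i) ∈ diffRing S) →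
      shift b (discreteContinuity D) ∈ diffRing S →
      shift c (discretePoisson D) ∈ diffRing S →
      SConsistent S
        ![shift (a 0) (discreteMomentum Dt D L 0),
          shift (a 1) (discreteMomentum Dt D L 1),
          shift (a 2) (discreteMomentum Dt D L 2),
          shift b (discreteContinuity D),
          shift c (discretePoisson D)]
        ![momentum 0, momentum 1, momentum 2, continuity, poisson]) := by
  refine ⟨fun h1 h2 h3 h4 h5 S hS h6 h7 s hs => ?_, fun S a b c ha hb hc => ?_⟩
  · exact isDifferenceGroebnerBasis_navierStokes h1 h2 h3 h4 h5 S hS h6 h7 s hs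
  · exact sConsistent_navierStokes hDt hD hL S a b c ha hb hc
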